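/- Let $n\ge 4$ be even, let $k\ge 2$ be an integer, and let $d$ be a distance function on $n$ teams $V=\{1,\dots,n\}$ with $d(i,j)\ge 0$, $d(i,i)=0$, $d(i,j)=d(j,i)$ and $d(i,h)\le d(i,j)+d(j,h)$ for all $i,j,h$. A feasible schedule for TTP-$k$ is a double round-robin tournament on $2(n-1)$ consecutive days in which every team plays exactly one game per day, every ordered pair $(i,j)$ of distinct teams meets exactly once at the home of $i$, no two teams play each other on two consecutive days, and no team plays more than $k$ consecutive home games or more than $k$ consecutive away games. Every team starts at home before the first day, travels directly from the venue of each of its games to the venue of its next game, and returns home after the last day; the weight of a schedule is the total distance traveled by all teams. Put $\Delta=\sum_{i}\sum_{j\ne i}d(i,j)$, and for a Hamiltonian cycle $T$ of the complete graph on $V$ let $d(T)$ be the total length of the edges of $T$. **Theorem.** There is a deterministic algorithm that, given $n$, $k$, $d$ and any Hamiltonian cycle $T$ of the complete graph on $V$, outputs, after a number of elementary steps that is at most a fixed polynomial in $n$, a feasible schedule for TTP-$k$ of weight at most $$\frac{10}{n}\Delta+\frac{2}{k}\Delta+\Big(1-\frac1k\Big)n\,d(T).$$ If moreover $k\ge n/2$,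 then the weight of the output schedule is at most $$\frac{10}{n}\Delta+\Big(1-\frac1k\Big)n\,d(T).$$ (The elementary steps are addition, subtraction, comparison and copying of natural numbers or of distances, and memory access through computed addresses.) -/

import Mathlib

/-! ## Machine model

A random access machine, given as a small imperative language.  A program works on finitely many
named two-dimensional arrays of natural numbers and finitely many named two-dimensional arrays of
real numbers (scalar variables are cells `(0, 0)` of an array).  It may add, subtract, copy and
compare numbers and address cells through computed indices; every such elementary operation, every
memory access, every constant, every assignment and every test counts as one step.  There is no
multiplication, no rounding and no real constant, so a unit-cost step bound is not an artefact of
packing long computations into large numbers. -/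

namespace RAM

/-- Memory contents: `s.nat x i j` is cell `(i, j)` of the natural number array named `x`, and
`s.real x i j` is cell `(i, j)` of the real number array named `x`. -/
@[ext]
structure Store where
  nat : ℕ → ℕ → ℕ → ℕ
  real : ℕ → ℕ → ℕ → ℝ

namespace Store

/-- Overwrite one cell of a natural number array. -/
def setNat (s : Store) (x i j v : ℕ) : Store where
  nat := fun x' i' j' => if x' = x ∧ i' = i ∧ j' = j then v else s.nat x' i' j'
  real := s.real

/-- Overwrite one cell of a real number array. -/
noncomputable def setReal (s : Store) (x i j : ℕ) (v : ℝ) : Store where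
  nat := s.nat
  real := fun x' i' j' => if x' = x ∧ i' = i ∧ j' = j then v else s.real x' i' j'

end Store

/-- Natural number expressions: constants, memory cells with computed indices, sum, truncated
difference. -/
inductive NExp where
  | lit (c : ℕ)
  | cell (x : ℕ) (i j : NExp)
  | add (a b : NExp)
  | sub (a b : NExp)

namespace NExp

def eval (s : Store) : NExp → ℕ
  | lit c => c
  | cell x i j => s.nat x (i.eval s) (j.eval s)
  | add a b => a.eval s + b.eval s
  | sub a b => a.eval s - b.eval s

/-- Number of elementary steps used to evaluate the expression. -/
def cost : NExp → ℕ
  | lit _ => 1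
  | cell _ i j => i.cost + j.cost + 1
  | add a b => a.cost + b.cost + 1
  | sub a b => a.cost + b.cost + 1

end NExp

/-- Real number expressions: memory cells with computed indices, sum, difference. -/
inductive RExp where
  | cell (x : ℕ) (i j : NExp)
  | add (a b : RExp)
  | sub (a b : RExp)

namespace RExp

noncomputable def eval (s : Store) : RExp → ℝ
  | cell x i j => s.real x (i.eval s) (j.eval s)
  | add a b => a.eval s + b.eval s
  | sub a b => a.eval s - b.eval s

def cost : RExp → ℕ
  | cell _ i j => i.cost + j.cost + 1
  | add a b => a.cost + b.cost + 1
  | sub a b => a.cost + b.cost + 1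

end RExp

/-- Tests. -/
inductive Test where
  | nle (a b : NExp)
  | rle (a b : RExp)
  | not (b : Test)
  | and (b c : Test)

namespace Test

def Holds (s : Store) : Test → Prop
  | nle a b => a.eval s ≤ b.eval s
  | rle a b => a.eval s ≤ b.eval s
  | not b => ¬ b.Holds s
  | and b c => b.Holds s ∧ c.Holds s

def cost : Test → ℕ
  | nle a b => a.cost + b.cost + 1
  | rle a b => a.cost + b.cost + 1
  | not b => b.cost + 1
  | and b c => b.cost + c.cost + 1

end Test

/-- Programs. -/
inductive Prog where
  | skip
  | setNat (x : ℕ) (i j e : NExp)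
  | setReal (x : ℕ) (i j : NExp) (e : RExp)
  | seq (p q : Prog)
  | ite (b : Test) (p q : Prog)
  | while (b : Test) (p : Prog)

/-- `Exec p s t s'`: the program `p`, started in memory `s`, halts after exactly `t` elementary
steps with memory `s'`. -/
inductive Exec : Prog → Store → ℕ → Store → Prop where
  | skip (s : Store) : Exec .skip s 1 s
  | setNat (s : Store) (x : ℕ) (i j e : NExp) :
      Exec (.setNat x i j e) s (i.cost + j.cost + e.cost + 1)
        (s.setNat x (i.eval s) (j.eval s) (e.eval s))
  | setReal (s : Store) (x : ℕ) (i j : NExp) (e : RExp) :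
      Exec (.setReal x i j e) s (i.cost + j.cost + e.cost + 1)
        (s.setReal x (i.eval s) (j.eval s) (e.eval s))
  | seq {p q : Prog} {s s' s'' : Store} {t t' : ℕ} :
      Exec p s t s' → Exec q s' t' s'' → Exec (.seq p q) s (t + t') s''
  | ite_true {b : Test} {p q : Prog} {s s' : Store} {t : ℕ} :
      b.Holds s → Exec p s t s' → Exec (.ite b p q) s (b.cost + t + 1) s'
  | ite_false {b : Test} {p q : Prog} {s s' : Store} {t : ℕ} :
      ¬ b.Holds s → Exec q s t s' → Exec (.ite b p q) s (b.cost + t + 1) s'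
  | while_false {b : Test} {p : Prog} {s : Store} :
      ¬ b.Holds s → Exec (.while b p) s (b.cost + 1) s
  | while_true {b : Test} {p : Prog} {s s' s'' : Store} {t t' : ℕ} :
      b.Holds s → Exec p s t s' → Exec (.while b p) s' t' s'' →
        Exec (.while b p) s (b.cost + t + t' + 1) s''

end RAM

/-! ## The traveling tournament problem -/

namespace TTP

/-- A symmetric nonnegative distance function with the triangle inequality on the teams
(distinct teams may be at distance `0`). -/
structure IsDistance {n : ℕ} (d : Fin n → Fin n → ℝ) : Prop where
  nonneg : ∀ i j, 0 ≤ d i j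
  self : ∀ i, d i i = 0
  symm : ∀ i j, d i j = d j i
  triangle : ∀ i j h, d i h ≤ d i j + d j h

/-- `s(i)`: the total distance of the edges incident with `i`. -/
noncomputable def incidentSum {n : ℕ} (d : Fin n → Fin n → ℝ) (i : Fin n) : ℝ :=
  ∑ j ∈ Finset.univ.erase i, d i j

/-- `Δ = ∑ i, s(i)`. -/
noncomputable def totalSum {n : ℕ} (d : Fin n → Fin n → ℝ) : ℝ :=
  ∑ i, incidentSum d i

/-- `d(T)`: the length of a walk `T`, the sum of `d` over its traversed edges. -/
noncomputable def walkLength {n : ℕ} (d : Fin n → Fin n → ℝ) {u v : Fin n}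
    (T : (⊤ : SimpleGraph (Fin n)).Walk u v) : ℝ :=
  (T.darts.map fun e => d e.fst e.snd).sum

/-- Assignment, to each of the `2(n-1)` days and each team, of the opponent of that team on that
day, and of whether the team plays at home. -/
structure Schedule (n : ℕ) where
  opp : Fin (2 * (n - 1)) → Fin n → Fin n
  home : Fin (2 * (n - 1)) → Fin n → Bool

namespace Schedule

variable {n : ℕ}

/-- The feasible solutions of TTP-`k`: double round-robin tournaments satisfying no-repeat and
bounded-by-`k`. -/
structure IsFeasible (S : Schedule n) (k : ℕ) : Prop where
  /-- On each day the teams are paired into games, one team of each pair being the host. -/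
  games : ∀ t i, S.opp t i ≠ i ∧ S.opp t (S.opp t i) = i ∧ S.home t (S.opp t i) = !S.home t i
  /-- Each team hosts each other team exactly once. -/
  roundRobin : ∀ i j, i ≠ j → ∃! t, S.opp t i = j ∧ S.home t i = true
  /-- No two teams play each other on two consecutive days. -/
  noRepeat : ∀ t t' : Fin (2 * (n - 1)), t'.val = t.val + 1 → ∀ i, S.opp t i ≠ S.opp t' i
  /-- No team has `k + 1` consecutive home games or `k + 1` consecutive away games. -/
  bounded : ∀ (i : Fin n) (h : Bool) (a : ℕ), a + k < 2 * (n - 1) →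
    ∃ t : Fin (2 * (n - 1)), a ≤ t.val ∧ t.val ≤ a + k ∧ S.home t i ≠ h

/-- Where team `i` is on day `t`, the game days being numbered `1, …, 2(n-1)`: at the venue of its
game, and at home before the first and after the last game day. -/
def venue (S : Schedule n) (i : Fin n) : ℕ → Fin n
  | 0 => i
  | t + 1 =>
    if h : t < 2 * (n - 1) then
      if S.home ⟨t, h⟩ i = true then i else S.opp ⟨t, h⟩ i
    else i

/-- The total distance traveled by all teams from day `0` to day `2(n-1) + 1`. -/
noncomputable def travel (S : Schedule n) (d : Fin n → Fin n → ℝ) : ℝ :=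
  ∑ i : Fin n, ∑ t ∈ Finset.range (2 * (n - 1) + 1), d (S.venue i t) (S.venue i (t + 1))

/-- Output convention: natural number array `3` holds the opponents and array `4` the home flags
(`1` for a home game, `0` for an away game), one row per day and one column per team. -/
def StoredIn (S : Schedule n) (s : RAM.Store) : Prop :=
  ∀ (t : Fin (2 * (n - 1))) (i : Fin n),
    s.nat 3 t i = (S.opp t i : ℕ) ∧ s.nat 4 t i = if S.home t i = true then 1 else 0

end Schedule

/-- Input convention: cell `(0, 0)` of natural number array `0` holds `n` and that of array `1`
holds `k`; row `0` of array `2` lists the vertices of the closed walk `T` in order; real number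
array `0` is the distance matrix.  All other cells are `0`. -/
noncomputable def input {n : ℕ} (k : ℕ) (d : Fin n → Fin n → ℝ) {v : Fin n}
    (T : (⊤ : SimpleGraph (Fin n)).Walk v v) : RAM.Store where
  nat := fun x i j =>
    if x = 0 ∧ i = 0 ∧ j = 0 then n
    else if x = 1 ∧ i = 0 ∧ j = 0 then k
    else if x = 2 ∧ i = 0 ∧ j < n then (T.getVert j : ℕ)
    else 0
  real := fun x i j =>
    if h : x = 0 ∧ i < n ∧ j < n then d ⟨i, h.2.1⟩ ⟨j, h.2.2⟩ else 0

end TTP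

/-! Write n = 2m + 2. One team sits at the centre of a circle and the other 2m + 1 are placed on it
in the order of `T`, labelled by residues mod 2m + 1. On a day of index u the teams a and b with a +
b = u meet, and the team with 2a = u meets the centre. Team a thus meets the team p = u - 2a places
ahead, and as u grows by one its opponent moves one step along the tour. The home flag depends on p
alone (centre games aside), is antisymmetric under p ↦ -p, and is constant on blocks of length k,
the first one shortened by an offset o. The second half of the season repeats the indices with all
flags complemented, starting two indices further back than the first; this separates the two
meetings of a pair and breaks home and away runs at the seam (`circleSchedule_isFeasible`).

For the weight, add up the two halves. If the flag is the same at p and p + 1, the team stays at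
home in one half and walks one tour edge in the other, so over all teams the step costs `chordSum D
1`, which is at most d(T). At a block boundary the team goes out in one half and comes back in the
other, which costs `chordSum D p + chordSum D (p + 1)`. Games involving the centre cost 4S, where S
is the distance sum of the centre; the seam and the two ends of the season cost `endCost`
(`sum_halfSeason_le`, `sum_steps_eq`).

Three choices remain. Some centre has S ≤ Δ/n (`exists_center`). Averaging over the starting index r
makes `endCost` at most 2(Δ - 2S)/(n - 1) (`exists_endCost_le`). Averaging over o leaves about a 1/k
share of all possible boundaries (`exists_block_ne_le`). The flag change in the middle of the circle
is unavoidable, and `card_mul_chordSum_le` bounds it by 4Δ/n. If k ≥ n/2 and o = 0, the middle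
change is the only boundary (`exists_travel_le_of_le`).

The algorithm tries every triple (c, r, o) of centre, starting index and offset and keeps the
schedule of least travel. Replacing k by min k n keeps the number of triples polynomial. Remainders
and parities of quotients are tabulated by recursion, since the machine cannot divide. Running time
is controlled by a syntactic polynomial `Prog.bound`, valid because each loop makes at most 8n
rounds whenever it is entered (`searchProg_spec`). -/

namespace RAM

/-! ### Program logic: step bounds, frame properties and loop rules. -/

open Polynomial

/-- Step bound of a program on inputs of size `n`, provided that every loop runs at most `8 n`
times whenever it is entered. -/
noncomputable def Prog.bound : Prog → ℕ[X]
  | .skip => 1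
  | .setNat _ i j e => C (i.cost + j.cost + e.cost + 1)
  | .setReal _ i j e => C (i.cost + j.cost + e.cost + 1)
  | .seq p q => p.bound + q.bound
  | .ite b p q => C (b.cost + 1) + p.bound + q.bound
  | .while b p => (8 * X + 1) * (C (b.cost + 1) + p.bound)

/-- The natural number arrays that a program may write to. -/
def Prog.natWrites : Prog → List ℕ
  | .skip => []
  | .setNat x _ _ _ => [x]
  | .setReal _ _ _ _ => []
  | .seq p q => p.natWrites ++ q.natWrites
  | .ite _ p q => p.natWrites ++ q.natWrites
  | .while _ p => p.natWrites

/-- The real number arrays that a program may write to. -/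
def Prog.realWrites : Prog → List ℕ
  | .skip => []
  | .setNat _ _ _ _ => []
  | .setReal x _ _ _ => [x]
  | .seq p q => p.realWrites ++ q.realWrites
  | .ite _ p q => p.realWrites ++ q.realWrites
  | .while _ p => p.realWrites

theorem Store.setNat_nat (s : Store) (x i j v x' i' j' : ℕ) :
    (s.setNat x i j v).nat x' i' j' = if x' = x ∧ i' = i ∧ j' = j then v else s.nat x' i' j' := rfl

theorem Store.setNat_real (s : Store) (x i j v : ℕ) : (s.setNat x i j v).real = s.real := rfl

theorem Store.setReal_nat (s : Store) (x i j : ℕ) (v : ℝ) : (s.setReal x i j v).nat = s.nat := rfl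

theorem Store.setReal_real (s : Store) (x i j : ℕ) (v : ℝ) (x' i' j' : ℕ) :
    (s.setReal x i j v).real x' i' j' =
      if x' = x ∧ i' = i ∧ j' = j then v else s.real x' i' j' := rfl

/-- Array names are literals in the syntax, so for a concrete program the side condition is settled
by `decide`; invariants about tables and parameters then survive any subprogram that does not write
to them. -/
theorem Exec.nat_frame {p : Prog} {s s' : Store} {t : ℕ} (h : Exec p s t s') {x : ℕ}
    (hx : x ∉ p.natWrites) : s'.nat x = s.nat x := by
  induction h with
  | skip | setReal | while_false => rfl
  | setNat s y i j e =>
    funext i' j'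
    simp only [Prog.natWrites, List.mem_singleton] at hx
    simp [Store.setNat_nat, hx]
  | seq _ _ ih₁ ih₂ =>
    simp only [Prog.natWrites, List.mem_append, not_or] at hx
    rw [ih₂ hx.2, ih₁ hx.1]
  | ite_true _ _ ih =>
    simp only [Prog.natWrites, List.mem_append, not_or] at hx
    exact ih hx.1
  | ite_false _ _ ih =>
    simp only [Prog.natWrites, List.mem_append, not_or] at hx
    exact ih hx.2
  | while_true _ _ _ ih₁ ih₂ => rw [ih₂ hx, ih₁ hx]

theorem Exec.real_frame {p : Prog} {s s' : Store} {t : ℕ} (h : Exec p s t s') {x : ℕ}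
    (hx : x ∉ p.realWrites) : s'.real x = s.real x := by
  induction h with
  | skip | setNat | while_false => rfl
  | setReal s y i j e =>
    funext i' j'
    simp only [Prog.realWrites, List.mem_singleton] at hx
    simp [Store.setReal_real, hx]
  | seq _ _ ih₁ ih₂ =>
    simp only [Prog.realWrites, List.mem_append, not_or] at hx
    rw [ih₂ hx.2, ih₁ hx.1]
  | ite_true _ _ ih =>
    simp only [Prog.realWrites, List.mem_append, not_or] at hx
    exact ih hx.1
  | ite_false _ _ ih =>
    simp only [Prog.realWrites, List.mem_append, not_or] at hx
    exact ih hx.2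
  | while_true _ _ _ ih₁ ih₂ => rw [ih₂ hx, ih₁ hx]

/-- `p`, started in memory `s`, halts within its step bound in a memory satisfying `Q`. -/
def Reaches (n : ℕ) (p : Prog) (s : Store) (Q : Store → Prop) : Prop :=
  ∃ t s', Exec p s t s' ∧ t ≤ p.bound.eval n ∧ Q s'

namespace Reaches

variable {n : ℕ} {s : Store} {Q R : Store → Prop}

theorem setNat {x : ℕ} {i j e : NExp} (h : Q (s.setNat x (i.eval s) (j.eval s) (e.eval s))) :
    Reaches n (.setNat x i j e) s Q :=
  ⟨_, _, .setNat s x i j e, by rw [Prog.bound, eval_C], h⟩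

theorem setReal {x : ℕ} {i j : NExp} {e : RExp}
    (h : Q (s.setReal x (i.eval s) (j.eval s) (e.eval s))) :
    Reaches n (.setReal x i j e) s Q :=
  ⟨_, _, .setReal s x i j e, by rw [Prog.bound, eval_C], h⟩

theorem skip (h : Q s) : Reaches n .skip s Q :=
  ⟨_, _, .skip s, by rw [Prog.bound, eval_one], h⟩

theorem seq {p q : Prog} (h : Reaches n p s fun s' => Reaches n q s' Q) :
    Reaches n (.seq p q) s Q := by
  obtain ⟨t, s', h₁, ht, t', s'', h₂, ht', hQ⟩ := h
  exact ⟨_, _, .seq h₁ h₂, by rw [Prog.bound, eval_add]; omega, hQ⟩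

theorem ite {b : Test} {p q : Prog} (h₁ : b.Holds s → Reaches n p s Q)
    (h₂ : ¬ b.Holds s → Reaches n q s Q) : Reaches n (.ite b p q) s Q := by
  by_cases hb : b.Holds s
  · obtain ⟨t, s', h, ht, hQ⟩ := h₁ hb
    exact ⟨_, _, .ite_true hb h, by rw [Prog.bound, eval_add, eval_add, eval_C]; omega, hQ⟩
  · obtain ⟨t, s', h, ht, hQ⟩ := h₂ hb
    exact ⟨_, _, .ite_false hb h, by rw [Prog.bound, eval_add, eval_add, eval_C]; omega, hQ⟩

theorem mono {p : Prog} (h : Reaches n p s Q) (hQ : ∀ s', Q s' → R s') : Reaches n p s R := by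
  obtain ⟨t, s', h, ht, hq⟩ := h
  exact ⟨t, s', h, ht, hQ _ hq⟩

/-- A program changes only the arrays that it writes to. -/
theorem frame {p : Prog} (h : Reaches n p s Q)
    (hR : ∀ s', (∀ x ∉ p.natWrites, s'.nat x = s.nat x) →
      (∀ x ∉ p.realWrites, s'.real x = s.real x) → Q s' → R s') : Reaches n p s R := by
  obtain ⟨t, s', h, ht, hq⟩ := h
  exact ⟨t, s', h, ht, hR _ (fun _ hx => h.nat_frame hx) (fun _ hx => h.real_frame hx) hq⟩

/-- The loop rule: `I x` holds after `x` rounds, and there are `M ≤ 8 n` rounds. -/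
theorem loop {b : Test} {p : Prog} (I : ℕ → Store → Prop) (M : ℕ) (hM : M ≤ 8 * n)
    (h0 : I 0 s) (hstep : ∀ x s, x < M → I x s → b.Holds s ∧ Reaches n p s (I (x + 1)))
    (hexit : ∀ s, I M s → ¬ b.Holds s ∧ Q s) : Reaches n (.while b p) s Q := by
  have key : ∀ j x s, x + j = M → I x s →
      ∃ t s', Exec (.while b p) s t s' ∧ t ≤ (j + 1) * (b.cost + 1 + p.bound.eval n) ∧ Q s' := by
    intro j
    induction j with
    | zero =>
      intro x s hx hI
      obtain rfl : x = M := hx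
      exact ⟨_, _, .while_false (hexit s hI).1, by omega, (hexit s hI).2⟩
    | succ j ih =>
      intro x s hx hI
      obtain ⟨hb, t, s', h, ht, hI'⟩ := hstep x s (by omega) hI
      obtain ⟨t', s'', h', ht', hQ⟩ := ih (x + 1) s' (by omega) hI'
      refine ⟨_, _, .while_true hb h h', ?_, hQ⟩
      rw [add_mul (j + 1)]
      omega
  obtain ⟨t, s', h, ht, hQ⟩ := key M 0 s (by omega) h0
  refine ⟨t, s', h, ht.trans ?_, hQ⟩
  have hb : (Prog.while b p).bound.eval n = (8 * n + 1) * (b.cost + 1 + p.bound.eval n) := by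
    simp [Prog.bound]
  rw [hb]
  gcongr

end Reaches

/-- The expression reading the scalar variable `x`. -/
def NExp.var (x : ℕ) : NExp := .cell x (.lit 0) (.lit 0)

/-- Assignment to the scalar variable `x`. -/
def Prog.assign (x : ℕ) (e : NExp) : Prog := .setNat x (.lit 0) (.lit 0) e

/-- Run `p` with the scalar variable `x` running through `0, …, e - 1`. -/
def Prog.count (x : ℕ) (e : NExp) (p : Prog) : Prog :=
  .seq (.assign x (.lit 0))
    (.while (.not (.nle e (.var x))) (.seq p (.assign x (.add (.var x) (.lit 1)))))

/-- The rule for counting loops whose body does not write to the counter. -/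
theorem Reaches.count {n : ℕ} {s : Store} {Q : Store → Prop} {x : ℕ} {e : NExp} {p : Prog}
    (I : ℕ → Store → Prop) (M : ℕ) (hM : M ≤ 8 * n) (hx : x ∉ p.natWrites)
    (h0 : I 0 (s.setNat x 0 0 0))
    (he : ∀ i s, I i s → e.eval s = M)
    (hstep : ∀ i s, i < M → I i s → s.nat x 0 0 = i →
      Reaches n p s fun s' => I (i + 1) (s'.setNat x 0 0 (i + 1)))
    (hexit : ∀ s, I M s → Q s) : Reaches n (.count x e p) s Q := by
  refine .seq (.setNat (.loop (fun i s => I i s ∧ s.nat x 0 0 = i) M hM ⟨h0, ?_⟩ ?_ ?_))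
  · simp [Store.setNat_nat, NExp.eval]
  · rintro i s hi ⟨hI, hc⟩
    refine ⟨?_, .seq ((hstep i s hi hI hc).frame ?_)⟩
    · simp [Test.Holds, NExp.eval, NExp.var, he i s hI, hc, hi]
    · intro s' hn _ hI'
      have hc' : s'.nat x 0 0 = i := by rw [hn x hx, hc]
      refine .setNat ⟨?_, ?_⟩
      · simpa [NExp.eval, NExp.var, hc'] using hI'
      · simp [Store.setNat_nat, NExp.eval, NExp.var, hc']
  · rintro s ⟨hI, hc⟩
    exact ⟨by simp [Test.Holds, NExp.eval, NExp.var, he M s hI, hc], hexit s hI⟩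

end RAM

/-! ### The circle method: opponents, home flags and feasibility. -/

namespace TTP

/-- The inverse of `2` modulo `2 m + 1`. -/
def half (m : ℕ) : ZMod (2 * m + 1) := ((m + 1 : ℕ) : ZMod (2 * m + 1))

theorem two_mul_half (m : ℕ) : 2 * half m = 1 := by
  have h : ((2 * m + 1 : ℕ) : ZMod (2 * m + 1)) = 0 := ZMod.natCast_self _
  unfold half
  push_cast at h ⊢
  linear_combination h

/-- Opponents on the day with index `u` of the circle method. The team `none` sits at the centre
of the circle. -/
def opponent {m : ℕ} (u : ZMod (2 * m + 1)) : Option (ZMod (2 * m + 1)) → Option (ZMod (2 * m + 1))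
  | none => some (half m * u)
  | some a => if u = 2 * a then none else some (u - a)

theorem opponent_some_eq_none {m : ℕ} {u a : ZMod (2 * m + 1)} :
    opponent u (some a) = none ↔ u = 2 * a := by
  simp [opponent]

theorem opponent_some_eq_some {m : ℕ} {u a b : ZMod (2 * m + 1)} :
    opponent u (some a) = some b ↔ a ≠ b ∧ u = a + b := by
  by_cases h : u = 2 * a
  · simp only [opponent, h, if_true, reduceCtorEq, false_iff, not_and]
    intro hab h2
    exact hab (by linear_combination h2)
  · simp only [opponent, h, if_false, Option.some.injEq]
    constructor
    · rintro rfl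
      exact ⟨fun h' => h (by linear_combination -h'), by ring⟩
    · rintro ⟨_, rfl⟩
      ring

theorem opponent_none_eq_some {m : ℕ} {u b : ZMod (2 * m + 1)} :
    opponent u none = some b ↔ u = 2 * b := by
  simp only [opponent, Option.some.injEq]
  constructor
  · rintro rfl
    linear_combination -u * two_mul_half m
  · rintro rfl
    linear_combination b * two_mul_half m

theorem opponent_ne {m : ℕ} (u : ZMod (2 * m + 1)) (x : Option (ZMod (2 * m + 1))) :
    opponent u x ≠ x := by
  cases x with
  | none => simp [opponent]
  | some a => rw [Ne, opponent_some_eq_some]; simp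

theorem opponent_opponent {m : ℕ} (u : ZMod (2 * m + 1)) (x : Option (ZMod (2 * m + 1))) :
    opponent u (opponent u x) = x := by
  cases hy : opponent u x with
  | none =>
    cases x with
    | none => simp [opponent] at hy
    | some a => rw [opponent_none_eq_some, ← opponent_some_eq_none, hy]
  | some b =>
    cases x with
    | none => rwa [opponent_some_eq_none, ← opponent_none_eq_some]
    | some a =>
      rw [opponent_some_eq_some] at hy ⊢
      exact ⟨hy.1.symm, hy.2.trans (add_comm a b)⟩

/-- The index is a + b for two teams on the circle and 2a when one of the teams is the centre. -/
theorem existsUnique_opponent {m : ℕ} {x y : Option (ZMod (2 * m + 1))} (h : x ≠ y) :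
    ∃! u, opponent u x = y := by
  cases x with
  | none =>
    cases y with
    | none => exact absurd rfl h
    | some b => simp only [opponent_none_eq_some]; exact ⟨_, rfl, fun _ h => h⟩
  | some a =>
    cases y with
    | none => simp only [opponent_some_eq_none]; exact ⟨_, rfl, fun _ h => h⟩
    | some b =>
      simp only [opponent_some_eq_some]
      exact ⟨_, ⟨fun h' => h (by rw [h']), rfl⟩, fun _ h => h.2⟩

theorem opponent_inj {m : ℕ} {u u' : ZMod (2 * m + 1)} {x : Option (ZMod (2 * m + 1))}
    (h : opponent u x = opponent u' x) : u = u' :=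
  (existsUnique_opponent (opponent_ne u' x).symm).unique h rfl

/-- Home flags in the first half of the circle: blocks of length `k` of alternating flags, the
first one cut short. -/
def block (k o p : ℕ) : Bool := decide (2 ≤ p ∧ (p + o) / k % 2 = 1)

/-- Home flag of the team that plays the team `p` places ahead of it. -/
def posHome (m k o p : ℕ) : Bool := if p ≤ m then block k o p else !block k o (2 * m + 1 - p)

/-- Home flags on the first day with index `u`. -/
def hosts {m : ℕ} (k o : ℕ) (u : ZMod (2 * m + 1)) : Option (ZMod (2 * m + 1)) → Bool
  | none => decide ((half m * u).val ≤ m)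
  | some a => if u = 2 * a then decide (m < a.val) else posHome m k o (u - 2 * a).val

theorem posHome_sub {m k o p : ℕ} (hp : p < 2 * m + 1) :
    posHome m k o (2 * m + 1 - p) = !posHome m k o p := by
  unfold posHome
  by_cases h : p ≤ m
  · rw [if_pos h, if_neg (by omega), Nat.sub_sub_self (by omega)]
  · rw [if_neg h, if_pos (by omega), Bool.not_not]

/-- Seen from the opponent u - a, the position p = u - 2a becomes -p, and `posHome` is built to be
antisymmetric under this reflection. For a game with the centre both flags are read off from whether
the label a is at most m. -/
theorem hosts_opponent {m : ℕ} (k o : ℕ) (u : ZMod (2 * m + 1)) (x : Option (ZMod (2 * m + 1))) :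
    hosts k o u (opponent u x) = !hosts k o u x := by
  have hval : ∀ a : ZMod (2 * m + 1), u = 2 * a → half m * u = a := by
    rintro a rfl
    linear_combination a * two_mul_half m
  cases x with
  | none =>
    have hu : u = 2 * (half m * u) := by linear_combination -u * two_mul_half m
    simp only [opponent, hosts, if_pos hu]
    by_cases h : (half m * u).val ≤ m <;> simp [h]; omega
  | some a =>
    by_cases hu : u = 2 * a
    · simp only [opponent, hosts, if_pos hu, hval a hu]
      by_cases h : a.val ≤ m <;> simp [h]; omega
    · have hu' : u ≠ 2 * (u - a) := fun h => hu (by linear_combination -h)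
      simp only [opponent, hosts, if_neg hu, if_neg hu']
      have hne : u - 2 * a ≠ 0 := sub_ne_zero.2 hu
      have hneg : u - 2 * (u - a) = -(u - 2 * a) := by ring
      have : NeZero (u - 2 * a) := ⟨hne⟩
      rw [hneg, ZMod.val_neg_of_ne_zero, posHome_sub (ZMod.val_lt _)]

theorem hosts_some {m k o q : ℕ} {u a : ZMod (2 * m + 1)} (hq : 0 < q) (hq' : q < 2 * m + 1)
    (hu : u = 2 * a + (q : ℕ)) : hosts k o u (some a) = posHome m k o q := by
  have hv : (u - 2 * a).val = q := by
    rw [hu, add_sub_cancel_left, ZMod.val_natCast, Nat.mod_eq_of_lt hq']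
  have hne : u ≠ 2 * a := by
    intro h
    rw [h, sub_self, ZMod.val_zero] at hv
    omega
  simp [hosts, hne, hv]

theorem block_add {k o p : ℕ} (hk : 2 ≤ k) (hp : 2 ≤ p) : block k o (p + k) = !block k o p := by
  unfold block
  have h : (p + k + o) / k = (p + o) / k + 1 := by
    rw [show p + k + o = p + o + k by ring, Nat.add_div_right _ (by omega)]
  rw [h]
  rcases Nat.mod_two_eq_zero_or_one ((p + o) / k) with h0 | h0
  · have : ((p + o) / k + 1) % 2 = 1 := by omega
    simp [h0, this]; omega
  · have : ((p + o) / k + 1) % 2 = 0 := by omega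
    simp [h0, this]; omega

/-- Together with `block_one` this guarantees a flag change among the positions 1, …, k, so that the
first block is not too long for any offset. -/
theorem block_self {k o : ℕ} (hk : 2 ≤ k) (ho : o < k) : block k o k = true := by
  have h : (k + o) / k = 1 := by
    rw [Nat.add_div_left _ (by omega), Nat.div_eq_of_lt ho]
  simp [block, h, hk]

theorem block_one {k o : ℕ} : block k o 1 = false := by simp [block]

/-- No `k + 1` cyclically consecutive equal flags. -/
theorem hosts_not_const {m k o : ℕ} (hm : 1 ≤ m) (hk : 2 ≤ k) (ho : o < k) (hkm : k ≤ 2 * m)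
    (u : ZMod (2 * m + 1)) (x : Option (ZMod (2 * m + 1))) :
    ∃ i ≤ k, ∃ j ≤ k, hosts k o (u + ((i : ℕ) : ZMod (2 * m + 1))) x ≠ hosts k o (u + ((j : ℕ) : ZMod (2 * m + 1))) x := by
  cases x with
  | none =>
    set g := half m * u with hg
    have hgl : g.val < 2 * m + 1 := ZMod.val_lt _
    have hg0 : ((g.val : ℕ) : ZMod (2 * m + 1)) = g := ZMod.natCast_zmod_val g
    have h2 := two_mul_half m
    have hN : ((2 * m + 1 : ℕ) : ZMod (2 * m + 1)) = 0 := ZMod.natCast_self _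
    push_cast at hN
    have hone : half m * (u + (1 : ℕ)) = ((g.val + (m + 1) : ℕ) : ZMod (2 * m + 1)) := by
      rw [Nat.cast_add, hg0, hg]
      simp only [half]
      push_cast
      ring
    have htwo : half m * (u + (2 : ℕ)) = ((g.val + 1 : ℕ) : ZMod (2 * m + 1)) := by
      rw [Nat.cast_add, hg0, hg]
      push_cast
      linear_combination h2
    have hzero : half m * (u + (0 : ℕ)) = g := by rw [hg]; simp
    -- The label of the centre's opponent advances by m + 1 each day. This switches between the
    -- labels at most m and those above m, except from m to 0; in that case the following day brings
    -- the switch.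
    by_cases hgm : g.val = m
    · refine ⟨1, by omega, 2, by omega, ?_⟩
      simp only [hosts, hone, htwo, hgm, ZMod.val_natCast]
      rw [show m + (m + 1) = 2 * m + 1 by ring, Nat.mod_self, Nat.mod_eq_of_lt (by omega)]
      simp
    · refine ⟨0, by omega, 1, by omega, ?_⟩
      simp only [hosts, hone, hzero, ZMod.val_natCast]
      by_cases h : g.val < m
      · rw [Nat.mod_eq_of_lt (by omega)]
        simp; omega
      · rw [show g.val + (m + 1) = g.val - m + (2 * m + 1) by omega, Nat.add_mod_right,
          Nat.mod_eq_of_lt (by omega)]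
        simp; omega
  | some a =>
    obtain ⟨p, hpl, hp⟩ : ∃ p < 2 * m + 1, u = 2 * a + (p : ℕ) :=
      ⟨(u - 2 * a).val, ZMod.val_lt _, by rw [ZMod.natCast_zmod_val]; ring⟩
    have key : ∀ q q', p ≤ q → q ≤ p + k → p ≤ q' → q' ≤ p + k → 0 < q → q < 2 * m + 1 →
        0 < q' → q' < 2 * m + 1 → posHome m k o q ≠ posHome m k o q' →
        ∃ i ≤ k, ∃ j ≤ k, hosts k o (u + ((i : ℕ) : ZMod (2 * m + 1))) (some a) ≠ hosts k o (u + ((j : ℕ) : ZMod (2 * m + 1))) (some a) := by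
      intro q q' h1 h2 h3 h4 h5 h6 h7 h8 hne
      refine ⟨q - p, by omega, q' - p, by omega, ?_⟩
      rwa [hosts_some h5 h6, hosts_some h7 h8]
      · rw [hp, add_assoc, ← Nat.cast_add, Nat.add_sub_cancel' h3]
      · rw [hp, add_assoc, ← Nat.cast_add, Nat.add_sub_cancel' h1]
    -- The window passes the centre game at position 0, so it contains the positions 2m and 1 on
    -- either side of it. Their flags differ because position 1 is always away, which makes the flag
    -- of the centre game itself irrelevant.
    by_cases c1 : 2 * m + 2 ≤ p + k
    · refine ⟨2 * m - p, by omega, 2 * m + 2 - p, by omega, ?_⟩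
      rw [hosts_some (q := 2 * m) (by omega) (by omega), hosts_some (q := 1) (by omega) (by omega)]
      · rw [posHome, posHome, if_neg (by omega), if_pos (by omega),
          show 2 * m + 1 - 2 * m = 1 by omega, block_one]
        simp
      · rw [hp, add_assoc, ← Nat.cast_add, Nat.add_sub_cancel' (by omega),
          show 2 * m + 2 = (2 * m + 1) + 1 by ring, Nat.cast_add, ZMod.natCast_self, zero_add]
      · rw [hp, add_assoc, ← Nat.cast_add, Nat.add_sub_cancel' (by omega)]
    by_cases c2 : p ≤ m
    · by_cases c3 : m + 1 ≤ p + k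
      · refine key m (m + 1) (by omega) (by omega) (by omega) (by omega) (by omega) (by omega)
          (by omega) (by omega) ?_
        rw [posHome, posHome, if_pos le_rfl, if_neg (by omega),
          show 2 * m + 1 - (m + 1) = m by omega]
        simp
      · by_cases c4 : 2 ≤ p
        · refine key p (p + k) (by omega) (by omega) (by omega) (by omega) (by omega) (by omega)
            (by omega) (by omega) ?_
          rw [posHome, posHome, if_pos c2, if_pos (by omega), block_add hk c4]
          simp
        · refine key 1 k (by omega) (by omega) (by omega) (by omega) (by omega) (by omega)
            (by omega) (by omega) ?_
          rw [posHome, posHome, if_pos hm, if_pos (by omega), block_self hk ho, block_one]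
          simp
    · by_cases c4 : p + k ≤ 2 * m - 1
      · refine key p (p + k) (by omega) (by omega) (by omega) (by omega) (by omega) (by omega)
          (by omega) (by omega) ?_
        rw [posHome, posHome, if_neg c2, if_neg (by omega),
          show 2 * m + 1 - p = 2 * m + 1 - (p + k) + k by omega, block_add hk (by omega)]
        simp
      · refine key (2 * m) (2 * m + 1 - k) (by omega) (by omega) (by omega) (by omega) (by omega)
          (by omega) (by omega) (by omega) ?_
        rw [posHome, posHome, if_neg (by omega), if_neg (by omega),
          show 2 * m + 1 - 2 * m = 1 by omega, show 2 * m + 1 - (2 * m + 1 - k) = k by omega,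
          block_self hk ho, block_one]
        simp

/-- The index of a day: the second half of the season starts two days further back on the
circle. -/
def dayIndex {m : ℕ} (r : ZMod (2 * m + 1)) (t : ℕ) : ZMod (2 * m + 1) :=
  if t < 2 * m + 1 then r + (t : ℕ) else r + (t : ℕ) - 2

/-- The tournament of the circle method, with the teams named by `e`. -/
def circleSchedule {m : ℕ} (e : Option (ZMod (2 * m + 1)) ≃ Fin (2 * m + 2)) (k o : ℕ)
    (r : ZMod (2 * m + 1)) : Schedule (2 * m + 2) where
  opp t i := e (opponent (dayIndex r t) (e.symm i))
  home t i := xor (hosts k o (dayIndex r t) (e.symm i)) (decide (2 * m + 1 ≤ t.val))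

/-- Each half of the season is a run of 2m + 1 consecutive indices and hence meets each residue
once. -/
theorem existsUnique_day {m : ℕ} (r u : ZMod (2 * m + 1)) (b : Bool) :
    ∃! t : ℕ, t < 2 * (2 * m + 1) ∧ dayIndex r t = u ∧ decide (2 * m + 1 ≤ t) = b := by
  have key : ∀ w : ZMod (2 * m + 1), ∃! t : ℕ, t < 2 * m + 1 ∧ (t : ZMod (2 * m + 1)) = w := by
    intro w
    refine ⟨w.val, ⟨ZMod.val_lt w, ZMod.natCast_zmod_val w⟩, ?_⟩
    rintro t ⟨ht, rfl⟩
    rw [ZMod.val_natCast, Nat.mod_eq_of_lt ht]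
  have hN : ((2 * m + 1 : ℕ) : ZMod (2 * m + 1)) = 0 := ZMod.natCast_self _
  cases b with
  | false =>
    obtain ⟨t, ⟨ht, hw⟩, huniq⟩ := key (u - r)
    refine ⟨t, ⟨by omega, ?_, by simpa using ht⟩, ?_⟩
    · rw [dayIndex, if_pos ht, hw]; ring
    · rintro t' ⟨_, h2, h3⟩
      have h3' : t' < 2 * m + 1 := by simpa using h3
      rw [dayIndex, if_pos h3'] at h2
      exact huniq t' ⟨h3', by linear_combination h2⟩
  | true =>
    obtain ⟨t, ⟨ht, hw⟩, huniq⟩ := key (u - r + 2)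
    refine ⟨t + (2 * m + 1), ⟨by omega, ?_, by simp⟩, ?_⟩
    · rw [dayIndex, if_neg (by omega), Nat.cast_add, hN, hw]; ring
    · rintro t' ⟨h1, h2, h3⟩
      have h3' : 2 * m + 1 ≤ t' := by simpa using h3
      rw [dayIndex, if_neg (by omega)] at h2
      have := huniq (t' - (2 * m + 1)) ⟨by omega, by
        rw [Nat.cast_sub h3', hN]; linear_combination h2⟩
      omega

theorem dayIndex_succ {m : ℕ} (r : ZMod (2 * m + 1)) {t : ℕ} (ht : t ≠ 2 * m) :
    dayIndex r (t + 1) = dayIndex r t + 1 := by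
  unfold dayIndex
  by_cases h : t < 2 * m + 1
  · rw [if_pos h, if_pos (by omega)]; push_cast; ring
  · rw [if_neg h, if_neg (by omega)]; push_cast; ring

/-- At the seam the index steps back by one instead of forward; it still changes, and this is what
excludes a repeated game there. -/
theorem dayIndex_succ_two_mul {m : ℕ} (r : ZMod (2 * m + 1)) :
    dayIndex r (2 * m + 1) = dayIndex r (2 * m) - 1 := by
  rw [dayIndex, dayIndex, if_neg (by omega), if_pos (by omega)]
  push_cast
  ring

theorem dayIndex_add {m : ℕ} (r : ZMod (2 * m + 1)) {t i : ℕ}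
    (h : t + i < 2 * m + 1 ∨ 2 * m + 1 ≤ t) : dayIndex r (t + i) = dayIndex r t + (i : ℕ) := by
  unfold dayIndex
  rcases h with h | h
  · rw [if_pos h, if_pos (by omega)]; push_cast; ring
  · rw [if_neg (by omega), if_neg (by omega)]; push_cast; ring

theorem one_ne_zero_circle {m : ℕ} (hm : 1 ≤ m) : (1 : ZMod (2 * m + 1)) ≠ 0 := by
  have : Fact (1 < 2 * m + 1) := ⟨by omega⟩
  exact one_ne_zero

theorem circleSchedule_isFeasible {m k k' o : ℕ} (hm : 1 ≤ m) (hk : 2 ≤ k) (ho : o < k)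
    (hkk : k ≤ k') (e : Option (ZMod (2 * m + 1)) ≃ Fin (2 * m + 2)) (r : ZMod (2 * m + 1)) :
    (circleSchedule e k o r).IsFeasible k' where
  games t i := by
    refine ⟨?_, ?_, ?_⟩
    · rw [Ne, ← e.symm.injective.eq_iff]
      simpa [circleSchedule] using opponent_ne _ _
    · simp [circleSchedule, opponent_opponent]
    · simp [circleSchedule, hosts_opponent]
  roundRobin i j hij := by
    have hxy : e.symm i ≠ e.symm j := fun h => hij (e.symm.injective h)
    obtain ⟨u, hu, huniq⟩ := existsUnique_opponent hxy
    -- The pair meets once in each half with opposite flags; the half is chosen so that `i` is the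
    -- host.
    obtain ⟨t, ⟨ht, htu, htb⟩, htuniq⟩ := existsUnique_day r u (!hosts k o u (e.symm i))
    refine ⟨⟨t, by omega⟩, ⟨?_, ?_⟩, ?_⟩
    · simp [circleSchedule, htu, hu]
    · simp only [circleSchedule, htu, htb]
      cases hosts k o u (e.symm i) <;> rfl
    · rintro ⟨t', ht'⟩ ⟨h1, h2⟩
      have hu' : dayIndex r t' = u := huniq _ (by
        apply e.injective; simpa [circleSchedule] using h1)
      simp only [circleSchedule, hu'] at h2
      refine Fin.ext (htuniq t' ⟨by omega, hu', ?_⟩)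
      revert h2
      cases hosts k o u (e.symm i) <;> simp
  noRepeat t t' htt i h := by
    have h' : dayIndex r t = dayIndex r t' :=
      opponent_inj (e.injective (by simpa [circleSchedule] using h))
    have h1 := one_ne_zero_circle hm
    rw [htt] at h'
    by_cases ht : t.val = 2 * m
    · rw [ht, dayIndex_succ_two_mul] at h'
      exact h1 (by linear_combination h')
    · rw [dayIndex_succ r ht] at h'
      exact h1 (by linear_combination -h')
  bounded i h a ha := by
    by_contra! hcon
    have hcon' : ∀ t, a ≤ t → t ≤ a + k →
        xor (hosts k o (dayIndex r t) (e.symm i)) (decide (2 * m + 1 ≤ t)) = h := by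
      intro t h1 h2
      exact hcon ⟨t, by omega⟩ h1 (by simp only; omega)
    by_cases hs : a + k < 2 * m + 1 ∨ 2 * m + 1 ≤ a
    · obtain ⟨i₁, h₁, i₂, h₂, hne⟩ :=
        hosts_not_const (o := o) hm hk ho (by omega) (dayIndex r a) (e.symm i)
      have e1 := hcon' (a + i₁) (by omega) (by omega)
      have e2 := hcon' (a + i₂) (by omega) (by omega)
      rw [dayIndex_add r (by omega)] at e1 e2
      apply hne
      have hd : decide (2 * m + 1 ≤ a + i₁) = decide (2 * m + 1 ≤ a + i₂) := by
        rw [decide_eq_decide]; omega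
      rw [hd, ← e2] at e1
      exact (Bool.xor_left_inj).1 e1
    -- For the last two days t of the first half, day t + 2 has the same index and the complemented
    -- flag. Since k ≥ 2, a window across the seam contains such a pair of days.
    · have hjump : ∀ t, t < 2 * m + 1 → 2 * m + 1 ≤ t + 2 → a ≤ t → t + 2 ≤ a + k → False := by
        intro t h1 h2 h3 h4
        have e1 := hcon' t h3 (by omega)
        have e2 := hcon' (t + 2) (by omega) h4
        have hd : dayIndex r (t + 2) = dayIndex r t := by
          rw [dayIndex, dayIndex, if_neg (by omega), if_pos h1]; push_cast; ring
        rw [hd, decide_eq_true h2, ← e1, decide_eq_false (by omega)] at e2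
        simp at e2
      by_cases hs' : a ≤ 2 * m - 1
      · exact hjump (2 * m - 1) (by omega) (by omega) hs' (by omega)
      · exact hjump (2 * m) (by omega) (by omega) (by omega) (by omega)

end TTP

/-! ### Travel of a circle schedule, accounted by position on the circle. -/

namespace TTP

open Finset

/-- A symmetric nonnegative function on pairs with the triangle inequality. -/
structure IsPseudoDist {α : Type*} (D : α → α → ℝ) : Prop where
  nonneg : ∀ x y, 0 ≤ D x y
  self : ∀ x, D x x = 0
  symm : ∀ x y, D x y = D y x
  triangle : ∀ x y z, D x z ≤ D x y + D y z

theorem IsDistance.isPseudoDist {n : ℕ} {d : Fin n → Fin n → ℝ} (hd : IsDistance d) {α : Type*}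
    (e : α → Fin n) : IsPseudoDist fun x y => d (e x) (e y) :=
  ⟨fun _ _ => hd.nonneg _ _, fun _ => hd.self _, fun _ _ => hd.symm _ _,
    fun _ _ _ => hd.triangle _ _ _⟩

variable {m : ℕ}

/-- Where a team plays on the day with index `u` of the first (`b = false`) or the second
(`b = true`) half of the season. -/
def circleVenue (k o : ℕ) (b : Bool) (u : ZMod (2 * m + 1)) (x : Option (ZMod (2 * m + 1))) :
    Option (ZMod (2 * m + 1)) :=
  if xor (hosts k o u x) b = true then x else opponent u x

/-- The distance traveled by a team in half a season that starts on day index `s`. -/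
noncomputable def halfSeason (D : Option (ZMod (2 * m + 1)) → Option (ZMod (2 * m + 1)) → ℝ)
    (k o : ℕ) (b : Bool) (s : ZMod (2 * m + 1)) (x : Option (ZMod (2 * m + 1))) : ℝ :=
  D x (circleVenue k o b s x)
    + ∑ t ∈ range (2 * m), D (circleVenue k o b (s + (t : ZMod (2 * m + 1))) x)
        (circleVenue k o b (s + (t : ZMod (2 * m + 1)) + 1) x)
    + D (circleVenue k o b (s - 1) x) x

theorem venue_circleSchedule (e : Option (ZMod (2 * m + 1)) ≃ Fin (2 * m + 2)) (k o : ℕ)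
    (r : ZMod (2 * m + 1)) (x : Option (ZMod (2 * m + 1))) {t : ℕ} (ht : t < 2 * (2 * m + 1)) :
    (circleSchedule e k o r).venue (e x) (t + 1) =
      e (circleVenue k o (decide (2 * m + 1 ≤ t)) (dayIndex r t) x) := by
  have ht' : t < 2 * (2 * m + 2 - 1) := by omega
  simp only [Schedule.venue, dif_pos ht', circleSchedule, circleVenue, e.symm_apply_apply]
  split_ifs <;> rfl

theorem natCast_two_mul : ((2 * m : ℕ) : ZMod (2 * m + 1)) = -1 := by
  have h : ((2 * m + 1 : ℕ) : ZMod (2 * m + 1)) = 0 := ZMod.natCast_self _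
  push_cast at h ⊢
  linear_combination h

/-- By the triangle inequality every team may be sent home between the halves, which decouples them
into two cyclic trips. -/
theorem travel_circleSchedule_le {d : Fin (2 * m + 2) → Fin (2 * m + 2) → ℝ} (hd : IsDistance d)
    (e : Option (ZMod (2 * m + 1)) ≃ Fin (2 * m + 2)) (k o : ℕ) (r : ZMod (2 * m + 1)) :
    (circleSchedule e k o r).travel d ≤
      ∑ x, (halfSeason (fun x y => d (e x) (e y)) k o false r x
        + halfSeason (fun x y => d (e x) (e y)) k o true (r - 2) x) := by
  unfold Schedule.travel
  rw [← e.sum_comp]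
  refine sum_le_sum fun x _ => ?_
  have hv := fun t (ht : t < 2 * (2 * m + 1)) => venue_circleSchedule e k o r x ht
  set S := circleSchedule e k o r with hS
  have hlast : S.venue (e x) (2 * (2 * m + 1) + 1) = e x := by
    rw [Schedule.venue, dif_neg (by omega)]
  have hfirst : S.venue (e x) 0 = e x := rfl
  have hday1 : ∀ t, t < 2 * m + 1 → S.venue (e x) (t + 1) =
      e (circleVenue k o false (r + (t : ZMod (2 * m + 1))) x) := by
    intro t ht
    rw [hv t (by omega), dayIndex, if_pos ht, decide_eq_false (by omega)]
  have hday2 : ∀ t, t < 2 * m + 1 → S.venue (e x) (2 * m + 1 + t + 1) =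
      e (circleVenue k o true (r - 2 + (t : ZMod (2 * m + 1))) x) := by
    intro t ht
    rw [hv _ (by omega), dayIndex, if_neg (by omega), decide_eq_true (by omega), Nat.cast_add,
      ZMod.natCast_self]
    congr 2
    ring
  have hm1 := natCast_two_mul (m := m)
  rw [show 2 * (2 * m + 2 - 1) + 1 = (2 * m + 1 + (2 * m + 1)) + 1 by omega, sum_range_succ',
    sum_range_add, sum_range_succ _ (2 * m), sum_range_succ _ (2 * m)]
  have e1 : ∑ t ∈ range (2 * m), d (S.venue (e x) (t + 1)) (S.venue (e x) (t + 1 + 1)) =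
      ∑ t ∈ range (2 * m), d (e (circleVenue k o false (r + (t : ZMod (2 * m + 1))) x))
        (e (circleVenue k o false (r + (t : ZMod (2 * m + 1)) + 1) x)) := by
    refine sum_congr rfl fun t ht => ?_
    have ht := mem_range.1 ht
    rw [hday1 t (by omega), hday1 (t + 1) (by omega)]
    push_cast
    rw [add_assoc]
  have e2 : ∑ t ∈ range (2 * m), d (S.venue (e x) (2 * m + 1 + t + 1))
        (S.venue (e x) (2 * m + 1 + t + 1 + 1)) =
      ∑ t ∈ range (2 * m), d (e (circleVenue k o true (r - 2 + (t : ZMod (2 * m + 1))) x))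
        (e (circleVenue k o true (r - 2 + (t : ZMod (2 * m + 1)) + 1) x)) := by
    refine sum_congr rfl fun t ht => ?_
    have ht := mem_range.1 ht
    rw [hday2 t (by omega), add_assoc (2 * m + 1), hday2 (t + 1) (by omega)]
    push_cast
    rw [add_assoc]
  have e3 := hday1 0 (by omega)
  have e4 := hday1 (2 * m) (by omega)
  have e5 := hday2 0 (by omega)
  have e6 := hday2 (2 * m) (by omega)
  simp only [Nat.cast_zero, add_zero, hm1, ← sub_eq_add_neg] at e3 e4 e5 e6
  rw [e1, e2, hfirst, e3, e4, e5, e6, show 2 * m + 1 + 2 * m + 1 + 1 = 2 * (2 * m + 1) + 1 by ring,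
    hlast]
  have htri := hd.triangle (e (circleVenue k o false (r - 1) x)) (e x)
    (e (circleVenue k o true (r - 2) x))
  simp only [halfSeason]
  linarith

theorem sum_add_shift (f : ZMod (2 * m + 1) → ℝ) (c : ZMod (2 * m + 1)) :
    ∑ u, f (u + c) = ∑ u, f u :=
  Equiv.sum_comp (Equiv.addRight c) f

theorem sum_zmod_eq_sum_range (f : ZMod (2 * m + 1) → ℝ) (s : ZMod (2 * m + 1)) :
    ∑ u, f u = ∑ t ∈ range (2 * m + 1), f (s + (t : ZMod (2 * m + 1))) := by
  refine sum_bij' (fun u _ => (u - s).val) (fun t _ => s + (t : ZMod (2 * m + 1)))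
    ?_ ?_ ?_ ?_ ?_
  · exact fun u _ => mem_range.2 (ZMod.val_lt _)
  · simp
  · intro u _; simp
  · intro t ht
    rw [add_sub_cancel_left, ZMod.val_natCast, Nat.mod_eq_of_lt (mem_range.1 ht)]
  · intro u _; simp

variable {D : Option (ZMod (2 * m + 1)) → Option (ZMod (2 * m + 1)) → ℝ}

/-- The flags of the two halves are complementary: the team is away in exactly one of them. -/
theorem sum_dist_circleVenue (hD : IsPseudoDist D) (k o : ℕ) (u : ZMod (2 * m + 1))
    (x : Option (ZMod (2 * m + 1))) :
    D x (circleVenue k o false u x) + D x (circleVenue k o true u x) = D x (opponent u x) := by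
  cases h : hosts k o u x <;> simp [circleVenue, h, hD.self]

/-- Returning home after every game is no shorter. This crude estimate is applied to the centre team
only, whose opponents do not follow the tour. -/
theorem halfSeason_le (hD : IsPseudoDist D) (k o : ℕ) (b : Bool) (s : ZMod (2 * m + 1))
    (x : Option (ZMod (2 * m + 1))) :
    halfSeason D k o b s x ≤ 2 * ∑ u, D x (circleVenue k o b u x) := by
  have h1 : ∀ t ∈ range (2 * m), D (circleVenue k o b (s + (t : ZMod (2 * m + 1))) x)
        (circleVenue k o b (s + (t : ZMod (2 * m + 1)) + 1) x) ≤
      D x (circleVenue k o b (s + (t : ZMod (2 * m + 1))) x)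
        + D x (circleVenue k o b (s + ((t + 1 : ℕ) : ZMod (2 * m + 1))) x) := by
    intro t _
    have := hD.triangle (circleVenue k o b (s + (t : ZMod (2 * m + 1))) x) x
      (circleVenue k o b (s + (t : ZMod (2 * m + 1)) + 1) x)
    rw [hD.symm _ x] at this
    push_cast
    rwa [← add_assoc]
  have h2 := sum_le_sum h1
  have h3 := sum_zmod_eq_sum_range (fun u => D x (circleVenue k o b u x)) s
  have h4 := h3
  rw [sum_range_succ, natCast_two_mul, ← sub_eq_add_neg] at h3
  rw [sum_range_succ', Nat.cast_zero, add_zero] at h4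
  rw [sum_add_distrib] at h2
  rw [halfSeason, hD.symm _ x]
  linarith

/-- The team at the centre. -/
theorem halfSeason_none_le (hD : IsPseudoDist D) (k o : ℕ) (s s' : ZMod (2 * m + 1)) :
    halfSeason D k o false s none + halfSeason D k o true s' none ≤
      2 * ∑ a, D none (some a) := by
  have h : ∑ a, D none (some a) =
      ∑ u, (D none (circleVenue k o false u none) + D none (circleVenue k o true u none)) := by
    simp only [sum_dist_circleVenue hD, opponent]
    -- The centre meets the team a on index 2a, and doubling permutes the residues because 2m + 1 is
    -- odd.
    refine Fintype.sum_equiv ⟨fun a => 2 * a, fun u => half m * u, ?_, ?_⟩ _ _ ?_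
    · intro a; linear_combination a * two_mul_half m
    · intro a; linear_combination a * two_mul_half m
    · intro a
      congr 2
      simp only [Equiv.coe_fn_mk]
      linear_combination -a * two_mul_half m
  have h1 := halfSeason_le hD k o false s none
  have h2 := halfSeason_le hD k o true s' none
  rw [h, sum_add_distrib]
  linarith

/-- The distance between the venues of two consecutive days, through the home venue if one of the
two games is against the centre. -/
noncomputable def transit (D : Option (ZMod (2 * m + 1)) → Option (ZMod (2 * m + 1)) → ℝ)
    (k o : ℕ) (b : Bool) (u a : ZMod (2 * m + 1)) : ℝ :=
  if u = 2 * a ∨ u + 1 = 2 * a then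
    D (some a) (circleVenue k o b u (some a)) + D (some a) (circleVenue k o b (u + 1) (some a))
  else D (circleVenue k o b u (some a)) (circleVenue k o b (u + 1) (some a))

/-- The distance between home and the venue of a game, if the game is not against the centre. -/
noncomputable def outer (D : Option (ZMod (2 * m + 1)) → Option (ZMod (2 * m + 1)) → ℝ)
    (k o : ℕ) (b : Bool) (u a : ZMod (2 * m + 1)) : ℝ :=
  if u = 2 * a then 0 else D (some a) (circleVenue k o b u (some a))

theorem outer_nonneg (hD : IsPseudoDist D) (k o : ℕ) (b : Bool) (u a : ZMod (2 * m + 1)) :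
    0 ≤ outer D k o b u a := by
  unfold outer
  split_ifs
  · exact le_rfl
  · exact hD.nonneg _ _

/-- Closing the trip to a full cycle of indices makes the main sum independent of the start s; only
the first and last legs depend on s, and they go into `outer`. -/
theorem halfSeason_some_le (hD : IsPseudoDist D) (k o : ℕ) (b : Bool) (s a : ZMod (2 * m + 1)) :
    halfSeason D k o b s (some a) ≤
      ∑ u, transit D k o b u a + (outer D k o b s a + outer D k o b (s - 1) a) := by
  have h1 : ∀ u, D (circleVenue k o b u (some a)) (circleVenue k o b (u + 1) (some a)) ≤
      transit D k o b u a := by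
    intro u
    unfold transit
    split_ifs
    · have := hD.triangle (circleVenue k o b u (some a)) (some a)
        (circleVenue k o b (u + 1) (some a))
      rwa [hD.symm _ (some a)] at this
    · exact le_rfl
  have h2 : D (some a) (circleVenue k o b s (some a))
        + D (some a) (circleVenue k o b (s - 1) (some a)) ≤
      transit D k o b (s - 1) a + (outer D k o b s a + outer D k o b (s - 1) a) := by
    -- If one of the two end games is against the centre, the closing `transit` already runs through
    -- home and pays for both end legs. This is why `outer` can ignore centre games.
    by_cases h : s - 1 = 2 * a ∨ s = 2 * a
    · have h3 := outer_nonneg hD k o b s a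
      have h4 := outer_nonneg hD k o b (s - 1) a
      rw [transit, sub_add_cancel, if_pos h]
      linarith
    · have h3 := hD.nonneg (circleVenue k o b (s - 1) (some a)) (circleVenue k o b s (some a))
      obtain ⟨h4, h5⟩ := not_or.1 h
      rw [transit, sub_add_cancel, if_neg h, outer, outer, if_neg h4, if_neg h5]
      linarith
  rw [sum_zmod_eq_sum_range _ s, sum_range_succ, natCast_two_mul, ← sub_eq_add_neg, halfSeason,
    hD.symm _ (some a)]
  have h3 := sum_le_sum fun t (_ : t ∈ range (2 * m)) => h1 (s + (t : ZMod (2 * m + 1)))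
  linarith

/-- The total distance between the teams that are `p` places apart on the circle. -/
noncomputable def chordSum (D : Option (ZMod (2 * m + 1)) → Option (ZMod (2 * m + 1)) → ℝ)
    (p : ZMod (2 * m + 1)) : ℝ :=
  ∑ a, D (some a) (some (a + p))

theorem chordSum_neg (hD : IsPseudoDist D) (p : ZMod (2 * m + 1)) :
    chordSum D (-p) = chordSum D p := by
  unfold chordSum
  rw [← sum_add_shift _ p]
  refine sum_congr rfl fun a _ => ?_
  rw [hD.symm]
  simp

theorem chordSum_shift (p q : ZMod (2 * m + 1)) :
    ∑ a, D (some (a + p)) (some (a + p + q)) = chordSum D q :=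
  sum_add_shift (fun a => D (some a) (some (a + q))) p

/-- The cost of the step from position `p` to position `p + 1`, summed over both halves of the
season and all teams on the circle. -/
theorem sum_transit_le (hD : IsPseudoDist D) (k o : ℕ) (p : ZMod (2 * m + 1)) (hm : 1 ≤ m) :
    ∑ a, (transit D k o false (2 * a + p) a + transit D k o true (2 * a + p) a) ≤
      (if p = 0 ∨ p = -1 then chordSum D 1 + ∑ a, D none (some a)
      else if posHome m k o p.val = posHome m k o (p + 1).val then chordSum D 1
      else chordSum D p + chordSum D (p + 1)) := by
  have h10 := one_ne_zero_circle hm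
  have hsum : ∀ u a, D (some a) (circleVenue k o false u (some a))
      + D (some a) (circleVenue k o false (u + 1) (some a))
      + (D (some a) (circleVenue k o true u (some a))
      + D (some a) (circleVenue k o true (u + 1) (some a))) =
      D (some a) (opponent u (some a)) + D (some a) (opponent (u + 1) (some a)) := by
    intro u a
    rw [← sum_dist_circleVenue hD k o u, ← sum_dist_circleVenue hD k o (u + 1)]
    ring
  have hopp : ∀ a q : ZMod (2 * m + 1), q ≠ 0 →
      opponent (2 * a + q) (some a) = some (a + q) := by
    intro a q hq
    rw [opponent_some_eq_some]
    exact ⟨by simpa using hq, by ring⟩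
  by_cases h0 : p = 0
  · subst h0
    rw [if_pos (Or.inl rfl), chordSum, ← sum_add_distrib]
    refine le_of_eq (sum_congr rfl fun a _ => ?_)
    rw [transit, transit, if_pos (by simp), if_pos (by simp), hsum, add_zero, hopp a 1 h10,
      opponent_some_eq_none.2 rfl, hD.symm _ none, add_comm]
  by_cases h1 : p = -1
  · subst h1
    rw [if_pos (Or.inr rfl), ← chordSum_neg hD 1, chordSum, ← sum_add_distrib]
    refine le_of_eq (sum_congr rfl fun a _ => ?_)
    rw [transit, transit, if_pos (by simp), if_pos (by simp), hsum, hopp a (-1) h0,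
      opponent_some_eq_none.2 (by ring), hD.symm _ none]
  have h2 : p + 1 ≠ 0 := fun h => h1 (by linear_combination h)
  rw [if_neg (by tauto)]
  have hne : ∀ a : ZMod (2 * m + 1), ¬ (2 * a + p = 2 * a ∨ 2 * a + p + 1 = 2 * a) := by
    intro a
    rw [add_assoc]
    simpa using ⟨h0, h2⟩
  have hh : ∀ a q : ZMod (2 * m + 1), q ≠ 0 →
      hosts k o (2 * a + q) (some a) = posHome m k o q.val := by
    intro a q hq
    simp [hosts, hq]
  simp only [transit, if_neg (hne _)]
  -- With equal flags one half costs nothing and the other a tour edge; with different flags one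
  -- half pays the trip out and the other the trip back.
  by_cases hf : posHome m k o p.val = posHome m k o (p + 1).val
  · rw [if_pos hf, ← chordSum_shift p]
    refine le_of_eq (sum_congr rfl fun a _ => ?_)
    simp only [circleVenue, add_assoc, hopp a p h0, hopp a (p + 1) h2, hh a p h0,
      hh a (p + 1) h2, hf]
    cases posHome m k o (p + 1).val <;> simp [hD.self]
  · rw [if_neg hf, chordSum, chordSum, ← sum_add_distrib]
    refine le_of_eq (sum_congr rfl fun a _ => ?_)
    simp only [circleVenue, add_assoc, hopp a p h0, hopp a (p + 1) h2, hh a p h0,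
      hh a (p + 1) h2]
    revert hf
    cases posHome m k o p.val <;> cases posHome m k o (p + 1).val <;>
      simp [hD.symm _ (some a), add_comm]

/-- The travel at the ends of the two halves of the season. -/
noncomputable def endCost (D : Option (ZMod (2 * m + 1)) → Option (ZMod (2 * m + 1)) → ℝ)
    (k o : ℕ) (r : ZMod (2 * m + 1)) : ℝ :=
  ∑ a, (outer D k o false r a + outer D k o false (r - 1) a
    + (outer D k o true (r - 2) a + outer D k o true (r - 2 - 1) a))

/-- As r runs over all residues, each of the four end legs runs over all games of its half, and the
complementary flags merge the halves into one full distance per game. Games with the centre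
contribute nothing. -/
theorem sum_endCost (hD : IsPseudoDist D) (k o : ℕ) :
    ∑ r, endCost D k o r = 2 * ∑ p, chordSum D p := by
  have hshift : ∀ (b : Bool) (c a : ZMod (2 * m + 1)),
      ∑ r, outer D k o b (r - c) a = ∑ r, outer D k o b r a := fun b c a => by
    simpa [sub_eq_add_neg] using sum_add_shift (fun r => outer D k o b r a) (-c)
  have h1 : ∀ a : ZMod (2 * m + 1), ∑ r, (outer D k o false r a + outer D k o true r a) =
      ∑ p, D (some a) (some (a + p)) := by
    intro a
    rw [← sum_add_shift _ (2 * a)]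
    refine sum_congr rfl fun p _ => ?_
    rw [add_comm p, outer, outer]
    by_cases hp : p = 0
    · simp [hp, hD.self]
    · have h2 : 2 * a + p ≠ 2 * a := by simpa using hp
      rw [if_neg h2, if_neg h2, sum_dist_circleVenue hD, opponent, if_neg h2]
      congr 2
      ring
  unfold endCost chordSum
  rw [sum_comm, sum_comm (f := fun p a => D (some a) (some (a + p))), mul_sum]
  refine sum_congr rfl fun a _ => ?_
  rw [← h1 a, sum_add_distrib, sum_add_distrib, sum_add_distrib]
  have : ∑ r, outer D k o true (r - 2 - 1) a = ∑ r, outer D k o true r a := by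
    rw [← hshift true (2 + 1) a]
    simp only [sub_sub]
  rw [this, hshift, hshift, sum_add_distrib]
  ring

/-- Half of the term with factor 4 is the centre team's own travel; the other half comes from the
steps at p = 0 and p = -1, where the circle teams pass from and to their centre game. -/
theorem sum_halfSeason_le (hD : IsPseudoDist D) (k o : ℕ) (r : ZMod (2 * m + 1)) (hm : 1 ≤ m) :
    ∑ x, (halfSeason D k o false r x + halfSeason D k o true (r - 2) x) ≤
      4 * ∑ a, D none (some a) + endCost D k o r
      + ∑ p, (if p = 0 ∨ p = -1 then chordSum D 1
          else if posHome m k o p.val = posHome m k o (p + 1).val then chordSum D 1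
          else chordSum D p + chordSum D (p + 1)) := by
  have h10 := one_ne_zero_circle hm
  rw [Fintype.sum_option]
  have h1 := halfSeason_none_le hD k o r (r - 2)
  have h2 := sum_le_sum fun a (_ : a ∈ univ) =>
    add_le_add (halfSeason_some_le hD k o false r a) (halfSeason_some_le hD k o true (r - 2) a)
  have h3 : ∑ a, ∑ u, (transit D k o false u a + transit D k o true u a) =
      ∑ p, ∑ a, (transit D k o false (2 * a + p) a + transit D k o true (2 * a + p) a) := by
    rw [sum_comm (f := fun p a =>
      transit D k o false (2 * a + p) a + transit D k o true (2 * a + p) a)]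
    refine sum_congr rfl fun a _ => ?_
    rw [← sum_add_shift _ (2 * a)]
    simp only [add_comm]
  have h4 := sum_le_sum fun p (_ : p ∈ univ) => sum_transit_le hD k o p hm
  have h5 : ∀ p : ZMod (2 * m + 1), (if p = 0 ∨ p = -1 then chordSum D 1 + ∑ a, D none (some a)
      else if posHome m k o p.val = posHome m k o (p + 1).val then chordSum D 1
      else chordSum D p + chordSum D (p + 1)) =
      (if p = 0 ∨ p = -1 then chordSum D 1
        else if posHome m k o p.val = posHome m k o (p + 1).val then chordSum D 1
        else chordSum D p + chordSum D (p + 1))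
      + ((if p = 0 then ∑ a, D none (some a) else 0)
        + (if p = -1 then ∑ a, D none (some a) else 0)) := by
    intro p
    have hne : (0 : ZMod (2 * m + 1)) ≠ -1 := fun h => h10 (by linear_combination h)
    by_cases hp : p = 0
    · simp [hp, hne]
    · by_cases hp' : p = -1
      · simp [hp', hne.symm]
      · simp [hp, hp']
  simp only [h5] at h4
  rw [sum_add_distrib (f := fun p => if p = 0 ∨ p = -1 then _ else _), sum_add_distrib,
    sum_ite_eq', sum_ite_eq', if_pos (mem_univ _), if_pos (mem_univ _)] at h4
  have h6 : ∑ a, (∑ u, transit D k o false u a + (outer D k o false r a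
        + outer D k o false (r - 1) a)
      + (∑ u, transit D k o true u a + (outer D k o true (r - 2) a
        + outer D k o true (r - 2 - 1) a))) =
      ∑ a, ∑ u, (transit D k o false u a + transit D k o true u a) + endCost D k o r := by
    rw [endCost, ← sum_add_distrib]
    refine sum_congr rfl fun a _ => ?_
    rw [sum_add_distrib]
    ring
  rw [h6, h3] at h2
  linarith

end TTP

/-! ### Counting block boundaries and averaging over the parameters. -/

namespace TTP

open Finset

variable {m : ℕ} {D : Option (ZMod (2 * m + 1)) → Option (ZMod (2 * m + 1)) → ℝ}

theorem chordSum_nonneg (hD : IsPseudoDist D) (p : ZMod (2 * m + 1)) : 0 ≤ chordSum D p :=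
  sum_nonneg fun _ _ => hD.nonneg _ _

theorem chordSum_zero (hD : IsPseudoDist D) : chordSum D 0 = 0 := by
  simp [chordSum, hD.self]

theorem chordSum_add_le (hD : IsPseudoDist D) (p q : ZMod (2 * m + 1)) :
    chordSum D (p + q) ≤ chordSum D p + chordSum D q := by
  rw [← chordSum_shift p q, chordSum, chordSum, ← sum_add_distrib]
  refine sum_le_sum fun a _ => ?_
  rw [← add_assoc]
  exact hD.triangle _ _ _

/-- What a boundary between two blocks after position `p` costs in addition to the tour. -/
noncomputable def boundaryCost
    (D : Option (ZMod (2 * m + 1)) → Option (ZMod (2 * m + 1)) → ℝ) (p : ℕ) : ℝ :=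
  chordSum D (p : ZMod (2 * m + 1)) + chordSum D ((p + 1 : ℕ) : ZMod (2 * m + 1)) - chordSum D 1

/-- Triangle inequality for the chords -p, p + 1 and their sum 1. -/
theorem boundaryCost_nonneg (hD : IsPseudoDist D) (p : ℕ) : 0 ≤ boundaryCost D p := by
  have h := chordSum_add_le hD (-(p : ZMod (2 * m + 1))) ((p + 1 : ℕ) : ZMod (2 * m + 1))
  rw [chordSum_neg hD, Nat.cast_add, neg_add_cancel_left, Nat.cast_one] at h
  rw [boundaryCost, Nat.cast_add, Nat.cast_one]
  linarith

theorem chordSum_sub (hD : IsPseudoDist D) {p : ℕ} (hp : p ≤ 2 * m + 1) :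
    chordSum D ((2 * m + 1 - p : ℕ) : ZMod (2 * m + 1)) = chordSum D (p : ZMod (2 * m + 1)) := by
  rw [Nat.cast_sub hp, ZMod.natCast_self, zero_sub, chordSum_neg hD]

theorem boundaryCost_reflect (hD : IsPseudoDist D) {p : ℕ} (hp : p ≤ 2 * m) :
    boundaryCost D (2 * m - p) = boundaryCost D p := by
  rw [boundaryCost, boundaryCost, show 2 * m - p = 2 * m + 1 - (p + 1) by omega,
    chordSum_sub hD (by omega), show 2 * m + 1 - (p + 1) + 1 = 2 * m + 1 - p by omega,
    chordSum_sub hD (by omega)]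
  ring

theorem sum_chordSum (hD : IsPseudoDist D) :
    ∑ p, chordSum D p = 2 * ∑ p ∈ range m, chordSum D ((p + 1 : ℕ) : ZMod (2 * m + 1)) := by
  rw [sum_zmod_eq_sum_range _ 0, show range (2 * m + 1) = range (m + m + 1) by
    rw [two_mul], sum_range_succ', sum_range_add]
  simp only [zero_add, Nat.cast_zero, chordSum_zero hD, add_zero]
  refine Eq.trans ?_ (two_mul _).symm
  congr 1
  rw [← sum_range_reflect]
  refine sum_congr rfl fun p hp => ?_
  have hp := mem_range.1 hp
  rw [← chordSum_sub hD (p := p + 1) (by omega)]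
  congr 2
  omega

/-- Each chord length from 1 to m appears twice among the boundaries, as p and as p + 1, except that
1 and m appear once; over all residues each length is also counted twice, as p and -p. -/
theorem sum_boundaryCost (hD : IsPseudoDist D) {l : ℕ} (hm : m = l + 1) :
    2 * ∑ p ∈ range l, boundaryCost D (p + 1) =
      2 * (∑ p, chordSum D p - chordSum D (m : ZMod (2 * m + 1)) - m * chordSum D 1) := by
  have h1 : ∑ p ∈ range m, chordSum D ((p + 1 : ℕ) : ZMod (2 * m + 1)) =
      ∑ p ∈ range l, chordSum D ((p + 1 : ℕ) : ZMod (2 * m + 1))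
        + chordSum D (m : ZMod (2 * m + 1)) := by
    conv_lhs => rw [show range m = range (l + 1) by rw [hm]]
    rw [sum_range_succ]
    congr 4
    exact hm.symm
  have h2 : ∑ p ∈ range m, chordSum D ((p + 1 : ℕ) : ZMod (2 * m + 1)) =
      ∑ p ∈ range l, chordSum D ((p + 1 + 1 : ℕ) : ZMod (2 * m + 1)) + chordSum D 1 := by
    conv_lhs => rw [show range m = range (l + 1) by rw [hm]]
    rw [sum_range_succ', zero_add, Nat.cast_one]
  have hml : (m : ℝ) = l + 1 := by rw [hm]; push_cast; ring
  simp only [boundaryCost]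
  rw [sum_sub_distrib, sum_add_distrib, sum_const, card_range, nsmul_eq_mul, sum_chordSum hD, hml]
  linarith

theorem posHome_of_le {m k o p : ℕ} (hp : p ≤ m) : posHome m k o p = block k o p := if_pos hp

theorem posHome_reflect {m k o p : ℕ} (h1 : 1 ≤ p) (h2 : p ≤ 2 * m - 1) :
    posHome m k o (2 * m - p) = posHome m k o (2 * m - p + 1) ↔
      posHome m k o p = posHome m k o (p + 1) := by
  rw [show 2 * m - p = 2 * m + 1 - (p + 1) by omega, posHome_sub (by omega),
    show 2 * m + 1 - (p + 1) + 1 = 2 * m + 1 - p by omega, posHome_sub (by omega), Bool.not_inj_iff]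
  exact eq_comm

/-- The total cost of all steps on the circle. -/
theorem sum_steps_eq (hD : IsPseudoDist D) (k o : ℕ) {l : ℕ} (hm : m = l + 1) :
    ∑ p : ZMod (2 * m + 1), (if p = 0 ∨ p = -1 then chordSum D 1
        else if posHome m k o p.val = posHome m k o (p + 1).val then chordSum D 1
        else chordSum D p + chordSum D (p + 1)) =
      2 * m * chordSum D 1 + 2 * chordSum D (m : ZMod (2 * m + 1))
        + 2 * ∑ p ∈ range l, if block k o (p + 1) = block k o (p + 2) then 0
            else boundaryCost D (p + 1) := by
  set G : ℕ → ℝ := fun t => if t = 0 ∨ t = 2 * m then 0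
    else if posHome m k o t = posHome m k o (t + 1) then 0 else boundaryCost D t with hG
  have hcast : ∀ t, t < 2 * m + 1 → ((t : ℕ) : ZMod (2 * m + 1)).val = t := fun t ht => by
    rw [ZMod.val_natCast, Nat.mod_eq_of_lt ht]
  have h1 : ∀ t ∈ range (2 * m + 1),
      (if (0 : ZMod (2 * m + 1)) + (t : ZMod (2 * m + 1)) = 0
          ∨ (0 : ZMod (2 * m + 1)) + (t : ZMod (2 * m + 1)) = -1 then chordSum D 1
        else if posHome m k o ((0 : ZMod (2 * m + 1)) + (t : ZMod (2 * m + 1))).val =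
            posHome m k o ((0 : ZMod (2 * m + 1)) + (t : ZMod (2 * m + 1)) + 1).val
          then chordSum D 1
        else chordSum D ((0 : ZMod (2 * m + 1)) + (t : ZMod (2 * m + 1)))
          + chordSum D ((0 : ZMod (2 * m + 1)) + (t : ZMod (2 * m + 1)) + 1)) =
      G t + chordSum D 1 := by
    intro t ht
    have ht := mem_range.1 ht
    have hz : ((t : ℕ) : ZMod (2 * m + 1)) = 0 ↔ t = 0 := by
      rw [← ZMod.val_eq_zero, hcast t ht]
    have hl : ((t : ℕ) : ZMod (2 * m + 1)) = -1 ↔ t = 2 * m := by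
      rw [← natCast_two_mul]
      constructor
      · intro h
        have := congrArg ZMod.val h
        rwa [hcast t ht, hcast _ (by omega)] at this
      · rintro rfl; rfl
    simp only [zero_add, hz, hl, hG]
    by_cases h : t = 0 ∨ t = 2 * m
    · simp [h]
    · have hs : (t : ZMod (2 * m + 1)) + 1 = ((t + 1 : ℕ) : ZMod (2 * m + 1)) := by push_cast; rfl
      simp only [if_neg h, hs]
      rw [hcast t ht, hcast (t + 1) (by omega)]
      split_ifs
      · simp
      · rw [boundaryCost]; ring
  rw [sum_zmod_eq_sum_range _ 0, sum_congr rfl h1, sum_add_distrib, sum_const, card_range,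
    nsmul_eq_mul, sum_range_succ, show range (2 * m) = range (l + 1 + l + 1) by
      rw [hm]; congr 1; ring,
    sum_range_succ', sum_range_add, sum_range_succ]
  have h2 : G 0 = 0 := by simp [hG]
  have h3 : G (2 * m) = 0 := by simp [hG]
  -- The step from m to m + 1 joins mirror images, so its flag always changes, and both of its
  -- chords have length m.
  have h4 : G (l + 1) = 2 * chordSum D (m : ZMod (2 * m + 1)) - chordSum D 1 := by
    rw [← hm, hG]
    have : posHome m k o m ≠ posHome m k o (m + 1) := by
      rw [show m + 1 = 2 * m + 1 - m by omega, posHome_sub (by omega)]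
      simp
    simp only [if_neg this]
    rw [if_neg (by omega), boundaryCost, show m + 1 = 2 * m + 1 - m by omega,
      chordSum_sub hD (by omega)]
    ring
  have h5 : ∀ p ∈ range l, G (p + 1) = if block k o (p + 1) = block k o (p + 2) then 0
      else boundaryCost D (p + 1) := by
    intro p hp
    have hp := mem_range.1 hp
    simp only [hG]
    rw [if_neg (by omega), posHome_of_le (by omega), posHome_of_le (by omega)]
  -- The reflection p ↦ 2m - p exchanges the steps of the two half-circles and preserves both the
  -- flag changes and their cost.
  have h6 : ∑ p ∈ range l, G (l + 1 + p + 1) = ∑ p ∈ range l, G (p + 1) := by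
    rw [← sum_range_reflect]
    refine sum_congr rfl fun p hp => ?_
    have hp := mem_range.1 hp
    rw [show l + 1 + (l - 1 - p) + 1 = 2 * m - (p + 1) by omega]
    have c1 : ¬ (2 * m - (p + 1) = 0 ∨ 2 * m - (p + 1) = 2 * m) := by omega
    have c2 : ¬ (p + 1 = 0 ∨ p + 1 = 2 * m) := by omega
    simp only [hG, if_neg c1, if_neg c2, boundaryCost_reflect hD (show p + 1 ≤ 2 * m by omega),
      posHome_reflect (m := m) (k := k) (o := o) (p := p + 1) (by omega) (by omega)]
  rw [h2, h3, h4, h6, sum_congr rfl h5]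
  push_cast
  ring

/-- Each place is a block boundary for at most one of the k offsets, apart from the first place,
which may be one for two offsets; that is the extra term. -/
theorem sum_block_ne_le (hD : IsPseudoDist D) {k : ℕ} (hk : 2 ≤ k) (l : ℕ) :
    ∑ o ∈ range k, ∑ p ∈ range l, (if block k o (p + 1) = block k o (p + 2) then 0
        else boundaryCost D (p + 1)) ≤
      ∑ p ∈ range l, boundaryCost D (p + 1) + boundaryCost D 1 := by
  have hcount : ∀ p, (∑ o ∈ range k, if block k o (p + 1) = block k o (p + 2) then 0
        else boundaryCost D (p + 1)) =
      #{o ∈ range k | ¬ block k o (p + 1) = block k o (p + 2)} * boundaryCost D (p + 1) := by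
    intro p
    rw [← nsmul_eq_mul, ← sum_const, sum_filter]
    exact sum_congr rfl fun o _ => by split_ifs <;> simp_all
  have hone : ∀ p, 1 ≤ p → #{o ∈ range k | ¬ block k o (p + 1) = block k o (p + 2)} ≤ 1 := by
    intro p hp
    -- A flag can change only where the quotient by k jumps, which pins down o modulo k.
    have hdvd : ∀ o, ¬ block k o (p + 1) = block k o (p + 2) → k ∣ p + 1 + o + 1 := by
      intro o ho
      by_contra hnd
      apply ho
      unfold block
      rw [decide_eq_decide, show p + 2 + o = p + 1 + o + 1 by ring, Nat.succ_div, if_neg hnd]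
      omega
    rw [card_le_one]
    intro o ho o' ho'
    rw [mem_filter, mem_range] at ho ho'
    have h1 := hdvd o ho.2
    have h2 := hdvd o' ho'.2
    rcases le_total o o' with h | h
    · have := Nat.eq_zero_of_dvd_of_lt ((Nat.dvd_sub h2 h1)) (by omega)
      omega
    · have := Nat.eq_zero_of_dvd_of_lt ((Nat.dvd_sub h1 h2)) (by omega)
      omega
  -- Position 1 is forced to be away whatever its quotient, so a change occurs exactly when position
  -- 2 is at home, which needs o + 2 ≥ k.
  have hzero : #{o ∈ range k | ¬ block k o (0 + 1) = block k o (0 + 2)} ≤ 2 := by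
    refine (card_le_card (t := {k - 2, k - 1}) ?_).trans card_le_two
    intro o ho
    rw [mem_filter, mem_range] at ho
    rw [mem_insert, mem_singleton]
    by_contra hcon
    apply ho.2
    rw [zero_add, block_one, block, Nat.div_eq_of_lt (by omega)]
    simp
  rw [sum_comm]
  simp only [hcount]
  cases l with
  | zero => simpa using boundaryCost_nonneg hD 1
  | succ l =>
    rw [sum_range_succ', sum_range_succ']
    have h1 : ∀ p ∈ range l, (#{o ∈ range k | ¬ block k o (p + 1 + 1) = block k o (p + 1 + 2)} : ℝ)
        * boundaryCost D (p + 1 + 1) ≤ boundaryCost D (p + 1 + 1) := by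
      intro p _
      have : (#{o ∈ range k | ¬ block k o (p + 1 + 1) = block k o (p + 1 + 2)} : ℝ) ≤ 1 := by
        exact_mod_cast hone (p + 1) (by omega)
      nlinarith [boundaryCost_nonneg hD (p + 1 + 1)]
    have h2 : (#{o ∈ range k | ¬ block k o (0 + 1) = block k o (0 + 2)} : ℝ) ≤ 2 := by
      exact_mod_cast hzero
    have h3 := boundaryCost_nonneg hD 1
    have h4 := mul_le_mul_of_nonneg_right h2 h3
    have h5 := sum_le_sum h1
    simp only [zero_add] at h4 ⊢
    linarith

theorem exists_endCost_le (hD : IsPseudoDist D) (k o : ℕ) :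
    ∃ r, endCost D k o r ≤ 2 * (∑ p, chordSum D p) / (2 * m + 1) := by
  obtain ⟨r, _, hr⟩ := exists_le_of_sum_le (s := univ (α := ZMod (2 * m + 1)))
    (f := fun r => endCost D k o r) (g := fun _ => 2 * (∑ p, chordSum D p) / (2 * m + 1))
    univ_nonempty (by
      rw [sum_endCost hD, sum_const, card_univ, ZMod.card, nsmul_eq_mul]
      push_cast
      rw [mul_div_cancel₀]
      positivity)
  exact ⟨r, hr⟩

theorem exists_block_ne_le (hD : IsPseudoDist D) {k : ℕ} (hk : 2 ≤ k) {l : ℕ} (hm : m = l + 1) :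
    ∃ o < k, 2 * ∑ p ∈ range l, (if block k o (p + 1) = block k o (p + 2) then 0
        else boundaryCost D (p + 1)) ≤
      2 / (k : ℝ) * (∑ p, chordSum D p - chordSum D (m : ZMod (2 * m + 1)) - m * chordSum D 1
        + 2 * chordSum D 1) := by
  -- The boundary after position 1 costs just the chord of length 2, at most two tour edges per
  -- team.
  have hb : boundaryCost D 1 ≤ 2 * chordSum D 1 := by
    have := chordSum_add_le hD 1 1
    rw [one_add_one_eq_two] at this
    rw [boundaryCost]
    push_cast
    linarith
  have hk0 : (k : ℝ) ≠ 0 := by positivity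
  obtain ⟨o, ho, h⟩ := exists_le_of_sum_le (s := range k)
    (f := fun o => 2 * ∑ p ∈ range l, (if block k o (p + 1) = block k o (p + 2) then 0
        else boundaryCost D (p + 1)))
    (g := fun _ => 2 / (k : ℝ) * (∑ p, chordSum D p - chordSum D (m : ZMod (2 * m + 1))
      - m * chordSum D 1 + 2 * chordSum D 1)) ⟨0, mem_range.2 (by omega)⟩ (by
      rw [sum_const, card_range, nsmul_eq_mul, ← mul_sum, ← mul_assoc, mul_div_cancel₀ _ hk0]
      have h1 := sum_block_ne_le hD hk l
      have h2 := sum_boundaryCost hD hm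
      linarith)
  exact ⟨o, mem_range.1 ho, h⟩

theorem sum_sum_eq (hD : IsPseudoDist D) :
    ∑ x, ∑ y, D x y = 2 * ∑ a, D none (some a) + ∑ p, chordSum D p := by
  simp only [Fintype.sum_option, hD.self, sum_add_distrib, hD.symm (some _) none]
  have : ∑ p, chordSum D p = ∑ a, ∑ b, D (some a) (some b) := by
    unfold chordSum
    rw [sum_comm]
    refine sum_congr rfl fun a _ => ?_
    rw [← sum_add_shift (fun b => D (some a) (some b)) a]
    exact sum_congr rfl fun p _ => by rw [add_comm p a]
  rw [this]
  ring

/-- Detour each chord through every one of the n teams y and sum: every circle team is an endpoint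
of two chords in the sum. -/
theorem card_mul_chordSum_le (hD : IsPseudoDist D) (p : ZMod (2 * m + 1)) :
    (2 * m + 2) * chordSum D p ≤ 2 * ∑ x, ∑ y, D x y := by
  have h1 : ∀ a : ZMod (2 * m + 1), (2 * m + 2) * D (some a) (some (a + p)) ≤
      ∑ y, D (some a) y + ∑ y, D (some (a + p)) y := by
    intro a
    have h := sum_le_sum fun y (_ : y ∈ univ) => hD.triangle (some a) y (some (a + p))
    rw [sum_const, card_univ, Fintype.card_option, ZMod.card, nsmul_eq_mul, sum_add_distrib] at h
    simp only [hD.symm _ (some (a + p))] at h ⊢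
    push_cast at h
    linarith
  have h2 := sum_le_sum fun a (_ : a ∈ univ) => h1 a
  rw [← mul_sum, sum_add_distrib, sum_add_shift (fun a => ∑ y, D (some a) y) p] at h2
  rw [Fintype.sum_option]
  have h3 : 0 ≤ ∑ y, D none y := sum_nonneg fun _ _ => hD.nonneg _ _
  unfold chordSum
  linarith

/-- The left side increases with S, and at S = Δ/n it is 4Δ/n + 2(n - 2)Δ/(n(n - 1)). -/
theorem four_mul_add_le {m : ℕ} {S Δ : ℝ} (hΔ : 0 ≤ Δ) (hS : (2 * m + 2) * S ≤ Δ) :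
    4 * S + 2 * (Δ - 2 * S) / (2 * m + 1) ≤ 6 * (Δ / (2 * m + 2)) := by
  have hn : (0 : ℝ) < 2 * m + 2 := by positivity
  have hN : (0 : ℝ) < 2 * m + 1 := by positivity
  rw [← mul_div_assoc, add_div' _ _ _ hN.ne', div_le_div_iff₀ hN hn]
  have h := mul_le_mul_of_nonneg_left hS (show (0 : ℝ) ≤ 8 * m by positivity)
  linarith

variable {d : Fin (2 * m + 2) → Fin (2 * m + 2) → ℝ}

theorem totalSum_eq {n : ℕ} {d : Fin n → Fin n → ℝ} (hd : IsDistance d) :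
    totalSum d = ∑ i, ∑ j, d i j := by
  refine sum_congr rfl fun i _ => ?_
  rw [incidentSum, sum_erase _ (hd.self i)]

theorem totalSum_nonneg {n : ℕ} {d : Fin n → Fin n → ℝ} (hd : IsDistance d) : 0 ≤ totalSum d :=
  sum_nonneg fun _ _ => sum_nonneg fun _ _ => hd.nonneg _ _

theorem totalSum_eq_sum_sum (hd : IsDistance d) (e : Option (ZMod (2 * m + 1)) ≃ Fin (2 * m + 2)) :
    totalSum d = ∑ x, ∑ y, d (e x) (e y) := by
  rw [totalSum_eq hd, ← e.sum_comp]
  exact sum_congr rfl fun x _ => (e.sum_comp _).symm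

/-- The bound on the travel before averaging. -/
theorem travel_circleSchedule_le' (hd : IsDistance d)
    (e : Option (ZMod (2 * m + 1)) ≃ Fin (2 * m + 2)) (k o : ℕ) (r : ZMod (2 * m + 1)) {l : ℕ}
    (hm : m = l + 1) :
    (circleSchedule e k o r).travel d ≤
      4 * ∑ a, d (e none) (e (some a)) + endCost (fun x y => d (e x) (e y)) k o r
      + (2 * m * chordSum (fun x y => d (e x) (e y)) 1
        + 2 * chordSum (fun x y => d (e x) (e y)) (m : ZMod (2 * m + 1))
        + 2 * ∑ p ∈ range l, if block k o (p + 1) = block k o (p + 2) then 0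
            else boundaryCost (fun x y => d (e x) (e y)) (p + 1)) := by
  have hD := hd.isPseudoDist e
  rw [← sum_steps_eq hD k o hm]
  exact (travel_circleSchedule_le hd e k o r).trans (sum_halfSeason_le hD k o r (by omega))

theorem exists_travel_le (hm : 1 ≤ m) (hd : IsDistance d)
    (e : Option (ZMod (2 * m + 1)) ≃ Fin (2 * m + 2)) {k : ℕ} (hk : 2 ≤ k) {L : ℝ}
    (hS : (2 * m + 2) * ∑ a, d (e none) (e (some a)) ≤ totalSum d)
    (hL : chordSum (fun x y => d (e x) (e y)) 1 ≤ L) :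
    ∃ o < k, ∃ r, (circleSchedule e k o r).travel d ≤
      10 * (totalSum d / (2 * m + 2)) + 2 / (k : ℝ) * totalSum d
        + (1 - 1 / (k : ℝ)) * (2 * m + 2) * L := by
  have hD := hd.isPseudoDist e
  obtain ⟨l, hl⟩ : ∃ l, m = l + 1 := ⟨m - 1, by omega⟩
  obtain ⟨o, ho, h1⟩ := exists_block_ne_le hD hk hl
  obtain ⟨r, h2⟩ := exists_endCost_le hD k o
  refine ⟨o, ho, r, ?_⟩
  have h3 := travel_circleSchedule_le' hd e k o r hl
  have h4 := sum_sum_eq hD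
  rw [← totalSum_eq_sum_sum hd e] at h4
  have h5 := card_mul_chordSum_le hD 1
  have h6 := card_mul_chordSum_le hD (m : ZMod (2 * m + 1))
  rw [← totalSum_eq_sum_sum hd e] at h5 h6
  have h7 := four_mul_add_le (totalSum_nonneg hd) hS
  have h8 := chordSum_nonneg hD 1
  have h9 : 0 ≤ ∑ a, d (e none) (e (some a)) := sum_nonneg fun _ _ => hd.nonneg _ _
  have h10 := chordSum_nonneg hD (m : ZMod (2 * m + 1))
  generalize ∑ a, d (e none) (e (some a)) = S at *
  generalize chordSum (fun x y => d (e x) (e y)) (m : ZMod (2 * m + 1)) = C at *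
  generalize chordSum (fun x y => d (e x) (e y)) 1 = A at *
  generalize ∑ p, chordSum (fun x y => d (e x) (e y)) p = P at *
  obtain rfl : P = totalSum d - 2 * S := by linarith
  generalize totalSum d = Δ at *
  have hn : (0 : ℝ) < 2 * m + 2 := by positivity
  have hA : A ≤ 2 * (Δ / (2 * m + 2)) := by
    rw [← mul_div_assoc, le_div_iff₀ hn]; linarith
  have hC : C ≤ 2 * (Δ / (2 * m + 2)) := by
    rw [← mul_div_assoc, le_div_iff₀ hn]; linarith
  have hK0 : 0 < 1 / (k : ℝ) := by positivity
  have hK : 1 / (k : ℝ) ≤ 1 / 2 := by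
    apply one_div_le_one_div_of_le <;> norm_num
    exact_mod_cast hk
  have hK2 : 2 / (k : ℝ) = 2 * (1 / (k : ℝ)) := by ring
  rw [hK2] at h1 ⊢
  generalize 1 / (k : ℝ) = K at *
  generalize Δ / (2 * m + 2) = q at *
  have hLm : (1 - K) * (2 * m + 2) * A ≤ (1 - K) * (2 * m + 2) * L :=
    mul_le_mul_of_nonneg_left hL (mul_nonneg (by linarith) hn.le)
  have e1 := mul_le_mul_of_nonneg_left hC (by linarith : 0 ≤ 1 - K)
  -- The coefficient of A exceeds the target (1 - K)(2m + 2) by 6K - 2. If this is positive, A ≤ 2q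
  -- and K ≤ 1/2 give the bound. With `e1`, which yields 2(1 - K)C ≤ 4(1 - K)q, the excess sums to
  -- 4q, so 6q becomes 10q.
  have e2 : (6 * K - 2) * A ≤ 4 * K * q := by
    rcases le_total (6 * K - 2) 0 with h | h
    · nlinarith
    · nlinarith
  have e3 : 0 ≤ K * S := mul_nonneg hK0.le h9
  linarith

theorem exists_travel_le_of_le (hm : 1 ≤ m) (hd : IsDistance d)
    (e : Option (ZMod (2 * m + 1)) ≃ Fin (2 * m + 2)) {k : ℕ} (hk : m + 1 ≤ k) {L : ℝ}
    (hS : (2 * m + 2) * ∑ a, d (e none) (e (some a)) ≤ totalSum d)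
    (hL : chordSum (fun x y => d (e x) (e y)) 1 ≤ L) :
    ∃ r, (circleSchedule e k 0 r).travel d ≤
      10 * (totalSum d / (2 * m + 2)) + 2 * m * L := by
  have hD := hd.isPseudoDist e
  obtain ⟨l, hl⟩ : ∃ l, m = l + 1 := ⟨m - 1, by omega⟩
  obtain ⟨r, h2⟩ := exists_endCost_le hD k 0
  refine ⟨r, ?_⟩
  -- All positions in question are at most m < k, so with offset 0 their quotients by k vanish and
  -- every flag is away.
  have h1 : ∑ p ∈ range l, (if block k 0 (p + 1) = block k 0 (p + 2) then 0
      else boundaryCost (fun x y => d (e x) (e y)) (p + 1)) = 0 := by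
    refine sum_eq_zero fun p hp => ?_
    have hp := mem_range.1 hp
    rw [if_pos]
    rw [block, block, Nat.div_eq_of_lt (by omega), Nat.div_eq_of_lt (by omega)]
    simp
  have h3 := travel_circleSchedule_le' hd e k 0 r hl
  rw [h1] at h3
  have h4 := sum_sum_eq hD
  rw [← totalSum_eq_sum_sum hd e] at h4
  have h6 := card_mul_chordSum_le hD (m : ZMod (2 * m + 1))
  rw [← totalSum_eq_sum_sum hd e] at h6
  have h7 := four_mul_add_le (totalSum_nonneg hd) hS
  rw [show ∑ p, chordSum (fun x y => d (e x) (e y)) p =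
    totalSum d - 2 * ∑ a, d (e none) (e (some a)) by linarith] at h2
  have hn : (0 : ℝ) < 2 * m + 2 := by positivity
  have hC : chordSum (fun x y => d (e x) (e y)) (m : ZMod (2 * m + 1)) ≤
      2 * (totalSum d / (2 * m + 2)) := by
    rw [← mul_div_assoc, le_div_iff₀ hn]; linarith
  have hLm : 2 * (m : ℝ) * chordSum (fun x y => d (e x) (e y)) 1 ≤ 2 * m * L :=
    mul_le_mul_of_nonneg_left hL (by positivity)
  linarith

end TTP

/-! ### From the Hamiltonian cycle to the circle. -/

namespace TTP

open Finset

section Tour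

variable {m : ℕ} {v : Fin (2 * m + 2)} (T : (⊤ : SimpleGraph (Fin (2 * m + 2))).Walk v v)

/-- The vertices of a closed walk in order, repeated periodically. -/
def tourVert (j : ℕ) : Fin (2 * m + 2) := T.getVert (j % (2 * m + 2))

variable {T}

theorem tourVert_add_period (j : ℕ) : tourVert T (j + (2 * m + 2)) = tourVert T j := by
  rw [tourVert, tourVert, Nat.add_mod_right]

theorem tourVert_inj (hT : T.IsHamiltonianCycle) {i j : ℕ} (h : tourVert T i = tourVert T j) :
    i % (2 * m + 2) = j % (2 * m + 2) := by
  have hl : T.length = 2 * m + 2 := by simpa using hT.length_eq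
  refine hT.isCycle.getVert_injOn' ?_ ?_ h
  · have := Nat.mod_lt i (show 0 < 2 * m + 2 by omega)
    rw [Set.mem_ofPred_eq]
    omega
  · have := Nat.mod_lt j (show 0 < 2 * m + 2 by omega)
    rw [Set.mem_ofPred_eq]
    omega

/-- The circle obtained from the tour by moving its vertex `c` to the centre. -/
noncomputable def naming (hT : T.IsHamiltonianCycle) (c : ℕ) :
    Option (ZMod (2 * m + 1)) ≃ Fin (2 * m + 2) :=
  Equiv.ofBijective (fun x => x.elim (tourVert T c) fun a => tourVert T (c + 1 + a.val)) <| by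
    rw [Fintype.bijective_iff_injective_and_card]
    have key : ∀ i j : ℕ, i < 2 * m + 2 → j < 2 * m + 2 →
        tourVert T (c + i) = tourVert T (c + j) → i = j := by
      intro i j hi hj h
      have := Nat.ModEq.add_left_cancel' c (tourVert_inj hT h)
      rwa [Nat.ModEq, Nat.mod_eq_of_lt hi, Nat.mod_eq_of_lt hj] at this
    refine ⟨?_, by simp⟩
    rintro (_ | a) (_ | b) h
    · rfl
    · have hb := ZMod.val_lt b
      have := key 0 (1 + b.val) (by omega) (by omega) (by simpa [← add_assoc] using h)
      omega
    · have ha := ZMod.val_lt a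
      have := key (1 + a.val) 0 (by omega) (by omega) (by simpa [← add_assoc] using h)
      omega
    · have ha := ZMod.val_lt a
      have hb := ZMod.val_lt b
      have := key (1 + a.val) (1 + b.val) (by omega) (by omega) (by simpa [← add_assoc] using h)
      exact congrArg some (ZMod.val_injective _ (by omega))

theorem naming_none (hT : T.IsHamiltonianCycle) (c : ℕ) : naming hT c none = tourVert T c := rfl

theorem naming_some (hT : T.IsHamiltonianCycle) (c : ℕ) (a : ZMod (2 * m + 1)) :
    naming hT c (some a) = tourVert T (c + 1 + a.val) := rfl

theorem walkLength_eq_sum (hT : T.IsHamiltonianCycle) (d : Fin (2 * m + 2) → Fin (2 * m + 2) → ℝ) :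
    walkLength d T = ∑ j ∈ range (2 * m + 2), d (tourVert T j) (tourVert T (j + 1)) := by
  have hl : T.length = 2 * m + 2 := by simpa using hT.length_eq
  have h1 : ∀ j ≤ 2 * m + 2, tourVert T j = T.getVert j := by
    intro j hj
    rcases hj.lt_or_eq with h | h
    · rw [tourVert, Nat.mod_eq_of_lt h]
    · rw [tourVert, h, Nat.mod_self, T.getVert_zero, T.getVert_of_length_le hl.le]
  have h2 : (T.darts.map fun e => d e.fst e.snd) =
      (List.range (2 * m + 2)).map fun j => d (tourVert T j) (tourVert T (j + 1)) := by
    refine List.ext_getElem (by simp [hl]) fun j hj hj' => ?_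
    have hj'' : j < 2 * m + 2 := by simpa using hj'
    simp only [List.getElem_map, List.getElem_range, SimpleGraph.Walk.darts_getElem_eq_getVert]
    rw [h1 j (by omega), h1 (j + 1) (by omega)]
  rw [walkLength, h2]
  rfl

theorem sum_range_periodic {n : ℕ} {g : ℕ → ℝ} (hg : ∀ j, g (j + n) = g j) (c : ℕ) :
    ∑ j ∈ range n, g (c + j) = ∑ j ∈ range n, g j := by
  induction c with
  | zero => simp
  | succ c ih =>
    rw [← ih]
    have h := sum_range_succ' (fun j => g (c + j)) n
    rw [sum_range_succ, hg, add_zero, add_left_inj] at h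
    rw [h]
    exact sum_congr rfl fun j _ => by rw [add_assoc, add_comm 1]

/-- Moving the vertex c to the centre replaces its two tour edges by the edge between its
neighbours, a shortcut. -/
theorem chordSum_naming_le (hT : T.IsHamiltonianCycle)
    {d : Fin (2 * m + 2) → Fin (2 * m + 2) → ℝ} (hd : IsDistance d) (c : ℕ) :
    chordSum (fun x y => d (naming hT c x) (naming hT c y)) 1 ≤ walkLength d T := by
  rw [walkLength_eq_sum hT, ← sum_range_periodic (n := 2 * m + 2)
      (g := fun j => d (tourVert T j) (tourVert T (j + 1)))
      (fun j => by simp only [tourVert_add_period, show ∀ j, j + (2 * m + 2) + 1 =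
        j + 1 + (2 * m + 2) by intro j; ring]) c,
    sum_range_succ', sum_range_succ, chordSum, sum_zmod_eq_sum_range _ 0, sum_range_succ]
  have hcast : ∀ t, t < 2 * m + 1 → ((t : ℕ) : ZMod (2 * m + 1)).val = t := fun t ht => by
    rw [ZMod.val_natCast, Nat.mod_eq_of_lt ht]
  have h1 : ∀ t ∈ range (2 * m),
      d (naming hT c (some (0 + (t : ZMod (2 * m + 1)))))
        (naming hT c (some (0 + (t : ZMod (2 * m + 1)) + 1))) =
      d (tourVert T (c + (t + 1))) (tourVert T (c + (t + 1) + 1)) := by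
    intro t ht
    have ht := mem_range.1 ht
    have hs : (t : ZMod (2 * m + 1)) + 1 = ((t + 1 : ℕ) : ZMod (2 * m + 1)) := by push_cast; rfl
    rw [zero_add, hs, naming_some, naming_some, hcast t (by omega), hcast (t + 1) (by omega)]
    congr 2 <;> ring
  have h2 : d (naming hT c (some (0 + ((2 * m : ℕ) : ZMod (2 * m + 1)))))
        (naming hT c (some (0 + ((2 * m : ℕ) : ZMod (2 * m + 1)) + 1))) =
      d (tourVert T (c + (2 * m + 1))) (tourVert T (c + 1)) := by
    rw [zero_add, natCast_two_mul, neg_add_cancel, naming_some, naming_some, ← natCast_two_mul,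
      hcast _ (by omega), ZMod.val_zero]
    congr 2
    ring
  have h3 := hd.triangle (tourVert T (c + (2 * m + 1))) (tourVert T c) (tourVert T (c + 1))
  rw [sum_congr rfl h1, h2]
  rw [← tourVert_add_period c, show c + (2 * m + 2) = c + (2 * m + 1) + 1 by ring] at h3
  rw [add_zero, show tourVert T c = tourVert T (c + (2 * m + 1) + 1) from
    (tourVert_add_period c).symm]
  linarith

/-- Some team has at most the average distance sum, and the tour visits it. -/
theorem exists_center (hT : T.IsHamiltonianCycle) {d : Fin (2 * m + 2) → Fin (2 * m + 2) → ℝ}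
    (hd : IsDistance d) :
    ∃ c < 2 * m + 2,
      (2 * m + 2) * ∑ a, d (naming hT c none) (naming hT c (some a)) ≤ totalSum d := by
  obtain ⟨i, _, hi⟩ := exists_le_of_sum_le (s := univ (α := Fin (2 * m + 2)))
    (f := fun i => (2 * m + 2) * incidentSum d i) (g := fun _ => totalSum d) univ_nonempty (by
      rw [← mul_sum, sum_const, card_univ, Fintype.card_fin, nsmul_eq_mul]
      push_cast
      exact le_rfl)
  have hc : ∃ c < 2 * m + 2, tourVert T c = i := by
    obtain ⟨x, rfl⟩ := (naming hT 0).surjective i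
    cases x with
    | none => exact ⟨0, by omega, rfl⟩
    | some a =>
      have := ZMod.val_lt a
      exact ⟨0 + 1 + a.val, by omega, rfl⟩
  obtain ⟨c, hc, rfl⟩ := hc
  refine ⟨c, hc, ?_⟩
  have h : ∑ a, d (naming hT c none) (naming hT c (some a)) = incidentSum d (tourVert T c) := by
    rw [incidentSum, sum_erase _ (hd.self _), ← (naming hT c).sum_comp, Fintype.sum_option,
      naming_none, hd.self, zero_add]
  rw [h]
  exact hi

end Tour

end TTP

/-! ### Programs that write and measure a schedule; correctness of the home flags. -/

namespace TTP

open RAM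

/-- Sends the memory cells `17` to the home flag and `15` to the position on the circle of the
team in cell `13`. The cells `0`, `8`, `9`, `10`, `11` hold `n`, `n - 1` and the parameters `c`,
`r`, `o`, cell `14` a representative of the day index, cell `16` the half of the season, array `5`
the remainders modulo `n - 1`, and array `6` the parities of the quotients by `k`. -/
def flagProg : Prog :=
  .seq (.assign 15 (.cell 5 (.lit 0) (.sub (.var 14) (.add (.var 13) (.var 13))))) <|
  .seq
    (.ite (.nle (.var 15) (.lit 0))
      (.ite (.nle (.var 8) (.add (.var 13) (.var 13))) (.assign 17 (.lit 1)) (.assign 17 (.lit 0)))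
      (.ite (.nle (.add (.var 15) (.var 15)) (.var 8))
        (.ite (.nle (.var 15) (.lit 1)) (.assign 17 (.lit 0))
          (.assign 17 (.cell 6 (.lit 0) (.add (.var 15) (.var 11)))))
        (.ite (.nle (.sub (.var 8) (.var 15)) (.lit 1)) (.assign 17 (.lit 1))
          (.assign 17 (.sub (.lit 1)
            (.cell 6 (.lit 0) (.add (.sub (.var 8) (.var 15)) (.var 11))))))))
    (.ite (.nle (.lit 1) (.var 16)) (.assign 17 (.sub (.lit 1) (.var 17))) .skip)

/-- The name of the team with index `e` on the circle. -/
def nameExp (e : NExp) : NExp := .cell 2 (.lit 0) (.add (.add (.var 9) (.lit 1)) e)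

/-- The name of the team at the centre. -/
def centerExp : NExp := .cell 2 (.lit 0) (.var 9)

/-- Writes the game of the team in cell `13`. -/
def gameProg : Prog :=
  .seq (.setNat 4 (.var 12) (nameExp (.var 13)) (.var 17)) <|
  .ite (.nle (.var 15) (.lit 0))
    (.seq (.setNat 3 (.var 12) (nameExp (.var 13)) centerExp) <|
      .seq (.setNat 3 (.var 12) centerExp (nameExp (.var 13)))
        (.setNat 4 (.var 12) centerExp (.sub (.lit 1) (.var 17))))
    (.setNat 3 (.var 12) (nameExp (.var 13))
      (nameExp (.cell 5 (.lit 0) (.add (.var 13) (.var 15)))))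

/-- Sets up the day index of the day in cell `12`. -/
def dayProg : Prog :=
  .ite (.nle (.var 8) (.var 12))
    (.seq (.assign 16 (.lit 1))
      (.assign 14 (.sub (.add (.add (.var 12) (.var 10)) (.add (.var 8) (.var 8))) (.lit 2))))
    (.seq (.assign 16 (.lit 0))
      (.assign 14 (.add (.add (.var 12) (.var 10)) (.add (.var 8) (.var 8)))))

/-- Writes the schedule with the parameters in cells `9`, `10`, `11`. -/
def buildProg : Prog :=
  .count 12 (.add (.var 8) (.var 8)) <| .seq dayProg <| .count 13 (.var 8) <| .seq flagProg gameProg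

/-- Sends real cell `1` to the total travel of the stored schedule. -/
def travelProg : Prog :=
  .seq (.setReal 1 (.lit 0) (.lit 0)
    (.sub (.cell 1 (.lit 0) (.lit 0)) (.cell 1 (.lit 0) (.lit 0)))) <|
  .count 18 (.var 0) <|
  .seq (.assign 19 (.var 18)) <|
  .seq
    (.count 12 (.add (.var 8) (.var 8)) <|
      .seq (.ite (.nle (.lit 1) (.cell 4 (.var 12) (.var 18))) (.assign 15 (.var 18))
        (.assign 15 (.cell 3 (.var 12) (.var 18)))) <|
      .seq (.setReal 1 (.lit 0) (.lit 0)
        (.add (.cell 1 (.lit 0) (.lit 0)) (.cell 0 (.var 19) (.var 15))))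
        (.assign 19 (.var 15)))
    (.setReal 1 (.lit 0) (.lit 0)
      (.add (.cell 1 (.lit 0) (.lit 0)) (.cell 0 (.var 19) (.var 18))))

variable {m : ℕ} {v : Fin (2 * m + 2)} {T : (⊤ : SimpleGraph (Fin (2 * m + 2))).Walk v v}

/-- The tables have been computed. -/
structure Ready (T : (⊤ : SimpleGraph (Fin (2 * m + 2))).Walk v v) (k : ℕ)
    (d : Fin (2 * m + 2) → Fin (2 * m + 2) → ℝ) (s : Store) : Prop where
  size : s.nat 0 0 0 = 2 * m + 2
  cyc : s.nat 8 0 0 = 2 * m + 1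
  bnd : s.nat 7 0 0 = k
  tour : ∀ j < 2 * (2 * m + 2), s.nat 2 0 j = tourVert T j
  rem : ∀ x < 5 * (2 * m + 2), s.nat 5 0 x = x % (2 * m + 1)
  par : ∀ x < 2 * (2 * m + 2), s.nat 6 0 x = x / k % 2
  dist : ∀ i j : Fin (2 * m + 2), s.real 0 i j = d i j

theorem Ready.congr {k : ℕ} {d : Fin (2 * m + 2) → Fin (2 * m + 2) → ℝ} {s s' : Store}
    (h : Ready T k d s) (hn : ∀ x ∈ [0, 2, 5, 6, 7, 8], s'.nat x = s.nat x)
    (hr : s'.real 0 = s.real 0) : Ready T k d s' where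
  size := by rw [hn 0 (by simp), h.size]
  cyc := by rw [hn 8 (by simp), h.cyc]
  bnd := by rw [hn 7 (by simp), h.bnd]
  tour := by rw [hn 2 (by simp)]; exact h.tour
  rem := by rw [hn 5 (by simp)]; exact h.rem
  par := by rw [hn 6 (by simp)]; exact h.par
  dist := by rw [hr]; exact h.dist

theorem Ready.setNat {k : ℕ} {d : Fin (2 * m + 2) → Fin (2 * m + 2) → ℝ} {s : Store}
    (h : Ready T k d s) {x i j w : ℕ} (hx : x ∉ [0, 2, 5, 6, 7, 8]) :
    Ready T k d (s.setNat x i j w) := by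
  refine h.congr (fun y hy => ?_) rfl
  funext i' j'
  rw [Store.setNat_nat, if_neg]
  rintro ⟨rfl, _⟩
  exact hx hy

theorem Ready.setReal {k : ℕ} {d : Fin (2 * m + 2) → Fin (2 * m + 2) → ℝ} {s : Store}
    (h : Ready T k d s) {x i j : ℕ} {w : ℝ} (hx : x ≠ 0) :
    Ready T k d (s.setReal x i j w) := by
  refine h.congr (fun y hy => rfl) ?_
  funext i' j'
  rw [Store.setReal_real, if_neg]
  rintro ⟨rfl, _⟩
  exact hx rfl

theorem eval_var (s : Store) (x : ℕ) : (NExp.var x).eval s = s.nat x 0 0 := rfl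

theorem setNat_nat_self (s : Store) (x i j v : ℕ) : (s.setNat x i j v).nat x i j = v := by
  simp [Store.setNat_nat]

theorem setNat_nat_of_ne (s : Store) {x y : ℕ} (i j v i' j' : ℕ) (h : y ≠ x) :
    (s.setNat x i j v).nat y i' j' = s.nat y i' j' := by
  simp [Store.setNat_nat, h]

/-- The value `0` or `1` of a flag. -/
def flagVal (b : Bool) : ℕ := if b = true then 1 else 0

theorem flagVal_not (b : Bool) : flagVal (!b) = 1 - flagVal b := by cases b <;> rfl

theorem flagVal_block {k o p : ℕ} (hp : 2 ≤ p) : flagVal (block k o p) = (p + o) / k % 2 := by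
  unfold flagVal block
  rcases Nat.mod_two_eq_zero_or_one ((p + o) / k) with h | h <;> simp [h, hp]

theorem flagVal_block_of_le {k o p : ℕ} (hp : p ≤ 1) : flagVal (block k o p) = 0 := by
  have : ¬ 2 ≤ p := by omega
  simp [flagVal, block, this]

/-- The bounds on cell `14` make the truncated difference with 2a an honest one and keep it inside
the remainder table. Comparisons with m are done by doubling, since only 2m + 1 is stored. -/
theorem flagProg_spec {n k o : ℕ} {d : Fin (2 * m + 2) → Fin (2 * m + 2) → ℝ} {s : Store}
    (hs : Ready T k d s) (ho : s.nat 11 0 0 = o) (hon : o < 2 * m + 2) {u a : ZMod (2 * m + 1)}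
    (ha : s.nat 13 0 0 = a.val) (hw : (s.nat 14 0 0 : ZMod (2 * m + 1)) = u)
    (hwl : 2 * a.val ≤ s.nat 14 0 0) (hwu : s.nat 14 0 0 < 5 * (2 * m + 2)) {b : Bool}
    (hb : s.nat 16 0 0 = flagVal b) :
    Reaches n flagProg s fun s' => s'.nat 15 0 0 = (u - 2 * a).val ∧
      s'.nat 17 0 0 = flagVal (xor (hosts k o u (some a)) b) := by
  have hp : s.nat 5 0 (s.nat 14 0 0 - (s.nat 13 0 0 + s.nat 13 0 0)) = (u - 2 * a).val := by
    rw [hs.rem _ (by omega), ← ZMod.val_natCast, Nat.cast_sub (by omega), hw, ha]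
    push_cast
    rw [ZMod.natCast_zmod_val]
    congr 1
    ring
  have hpl := ZMod.val_lt (u - 2 * a)
  have hp0 : (u - 2 * a).val = 0 ↔ u = 2 * a := by rw [ZMod.val_eq_zero, sub_eq_zero]
  set p := (u - 2 * a).val with hpdef
  refine .seq (.setNat ?_)
  simp only [NExp.eval, eval_var, hp]
  set s₁ := s.setNat 15 0 0 p with hs₁
  have hR : Ready T k d s₁ := hs.setNat (by simp)
  have h15 : s₁.nat 15 0 0 = p := setNat_nat_self ..
  have hne : ∀ y ≠ 15, s₁.nat y 0 0 = s.nat y 0 0 := fun y hy => setNat_nat_of_ne _ _ _ _ _ _ hy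
  have main : Reaches n (.ite (.nle (.var 15) (.lit 0))
      (.ite (.nle (.var 8) (.add (.var 13) (.var 13))) (.assign 17 (.lit 1)) (.assign 17 (.lit 0)))
      (.ite (.nle (.add (.var 15) (.var 15)) (.var 8))
        (.ite (.nle (.var 15) (.lit 1)) (.assign 17 (.lit 0))
          (.assign 17 (.cell 6 (.lit 0) (.add (.var 15) (.var 11)))))
        (.ite (.nle (.sub (.var 8) (.var 15)) (.lit 1)) (.assign 17 (.lit 1))
          (.assign 17 (.sub (.lit 1)
            (.cell 6 (.lit 0) (.add (.sub (.var 8) (.var 15)) (.var 11)))))))) s₁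
      fun s' => s'.nat 17 0 0 = flagVal (hosts k o u (some a)) := by
    have h17 : ∀ e : NExp, e.eval s₁ = flagVal (hosts k o u (some a)) →
        Reaches n (.assign 17 e) s₁ fun s' => s'.nat 17 0 0 = flagVal (hosts k o u (some a)) := by
      intro e he
      refine .setNat ?_
      simp only [NExp.eval]
      rw [setNat_nat_self, he]
    have h8 := hR.cyc
    have h11 := hne 11 (by omega)
    have h13 := hne 13 (by omega)
    refine .ite (fun h => ?_) (fun h => ?_)
    · have hu : u = 2 * a := by
        rw [← hp0]
        simpa [Test.Holds, NExp.eval, eval_var, h15] using h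
      refine .ite (fun h' => h17 _ ?_) (fun h' => h17 _ ?_)
      · simp only [Test.Holds, NExp.eval, eval_var, h8, h13, ha] at h'
        rw [hosts, if_pos hu, decide_eq_true (by omega)]; rfl
      · simp only [Test.Holds, NExp.eval, eval_var, h8, h13, ha] at h'
        rw [hosts, if_pos hu, decide_eq_false (by omega)]; rfl
    · have hu : ¬ u = 2 * a := by
        rw [← hp0]
        simpa [Test.Holds, NExp.eval, eval_var, h15] using h
      rw [hosts, if_neg hu, ← hpdef] at h17 ⊢
      refine .ite (fun h' => ?_) (fun h' => ?_)
      · simp only [Test.Holds, NExp.eval, eval_var, h8, h15] at h'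
        rw [posHome, if_pos (by omega)] at h17 ⊢
        refine .ite (fun h'' => h17 _ ?_) (fun h'' => h17 _ ?_)
        · simp only [Test.Holds, NExp.eval, eval_var, h15] at h''
          rw [flagVal_block_of_le h'']; rfl
        · simp only [Test.Holds, NExp.eval, eval_var, h15] at h''
          rw [flagVal_block (by omega)]
          simp only [NExp.eval, eval_var, h15, h11, ho]
          exact hR.par _ (by omega)
      · simp only [Test.Holds, NExp.eval, eval_var, h8, h15] at h'
        rw [posHome, if_neg (by omega), flagVal_not] at h17 ⊢
        refine .ite (fun h'' => h17 _ ?_) (fun h'' => h17 _ ?_)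
        · simp only [Test.Holds, NExp.eval, eval_var, h8, h15] at h''
          rw [flagVal_block_of_le h'']; rfl
        · simp only [Test.Holds, NExp.eval, eval_var, h8, h15] at h''
          rw [flagVal_block (by omega)]
          simp only [NExp.eval, eval_var, h8, h15, h11, ho]
          rw [hR.par _ (by omega)]
  refine .seq (main.frame fun s₂ hn _ h17 => ?_)
  have h15' : s₂.nat 15 0 0 = p := by rw [hn 15 (by decide), h15]
  have h16 : s₂.nat 16 0 0 = flagVal b := by rw [hn 16 (by decide), hne 16 (by omega), hb]
  refine .ite (fun h => .setNat ?_) (fun h => .skip ?_)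
  · simp only [Test.Holds, NExp.eval, eval_var, h16] at h
    simp only [NExp.eval, eval_var]
    rw [setNat_nat_self, setNat_nat_of_ne _ _ _ _ _ _ (by omega), h17]
    refine ⟨h15', ?_⟩
    cases b
    · exact absurd h (by decide)
    · rw [Bool.xor_true, flagVal_not]
  · simp only [Test.Holds, NExp.eval, eval_var, h16] at h
    refine ⟨h15', ?_⟩
    cases b
    · rw [Bool.xor_false, h17]
    · exact absurd (by decide) h

end TTP

/-! ### Correctness of writing a schedule and of computing its travel. -/

namespace TTP

open RAM

variable {m : ℕ} {v : Fin (2 * m + 2)} {T : (⊤ : SimpleGraph (Fin (2 * m + 2))).Walk v v}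

/-- The games of team `i` on day `t` have been written. -/
def GameAt (e : Option (ZMod (2 * m + 1)) ≃ Fin (2 * m + 2)) (k o : ℕ) (r : ZMod (2 * m + 1))
    (s : Store) (t : ℕ) (i : Fin (2 * m + 2)) : Prop :=
  s.nat 3 t i = (e (opponent (dayIndex r t) (e.symm i)) : ℕ) ∧
    s.nat 4 t i = flagVal (xor (hosts k o (dayIndex r t) (e.symm i)) (decide (2 * m + 1 ≤ t)))

section

variable {e : Option (ZMod (2 * m + 1)) ≃ Fin (2 * m + 2)} {k o : ℕ} {r : ZMod (2 * m + 1)}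

theorem GameAt.congr {s s' : Store} {t : ℕ} {i : Fin (2 * m + 2)} (h : GameAt e k o r s t i)
    (h3 : s'.nat 3 = s.nat 3) (h4 : s'.nat 4 = s.nat 4) : GameAt e k o r s' t i := by
  unfold GameAt
  rw [h3, h4]
  exact h

theorem GameAt.setNat {s : Store} {t x i' j' w : ℕ} {i : Fin (2 * m + 2)}
    (h : GameAt e k o r s t i) (h3 : 3 ≠ x) (h4 : 4 ≠ x) :
    GameAt e k o r (s.setNat x i' j' w) t i :=
  h.congr (by funext i j; exact setNat_nat_of_ne _ _ _ _ _ _ h3)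
    (by funext i j; exact setNat_nat_of_ne _ _ _ _ _ _ h4)

theorem storedIn_circleSchedule {s : Store}
    (h : ∀ t < 2 * (2 * m + 1), ∀ i, GameAt e k o r s t i) :
    (circleSchedule e k o r).StoredIn s := fun t i => h t (by omega) i

end

/-- The tables and the parameters of a schedule. -/
structure Setup (T : (⊤ : SimpleGraph (Fin (2 * m + 2))).Walk v v) (k : ℕ)
    (d : Fin (2 * m + 2) → Fin (2 * m + 2) → ℝ) (c r o : ℕ) (s : Store) : Prop
    extends Ready T k d s where
  center : s.nat 9 0 0 = c
  shift : s.nat 10 0 0 = r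
  offset : s.nat 11 0 0 = o

section

variable {k : ℕ} {d : Fin (2 * m + 2) → Fin (2 * m + 2) → ℝ} {c r o : ℕ} {s : Store}

theorem Setup.congr {s' : Store} (h : Setup T k d c r o s)
    (hn : ∀ x ∈ [0, 2, 5, 6, 7, 8, 9, 10, 11], s'.nat x = s.nat x)
    (hr : s'.real 0 = s.real 0) : Setup T k d c r o s' where
  toReady := h.toReady.congr (fun x hx => hn x (by simp at hx ⊢; tauto)) hr
  center := by rw [hn 9 (by simp), h.center]
  shift := by rw [hn 10 (by simp), h.shift]
  offset := by rw [hn 11 (by simp), h.offset]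

theorem Setup.setNat {x i j w : ℕ} (h : Setup T k d c r o s)
    (hx : x ∉ [0, 2, 5, 6, 7, 8, 9, 10, 11]) : Setup T k d c r o (s.setNat x i j w) := by
  refine h.congr (fun y hy => ?_) rfl
  funext i' j'
  exact setNat_nat_of_ne _ _ _ _ _ _ fun hxy => hx (hxy ▸ hy)

variable (hT : T.IsHamiltonianCycle)

/-- Games already written stay correct because any entry that is overwritten receives its correct
value. The centre has no round of its own in the loop, so its entry is written with that of its
opponent. -/
theorem gameProg_spec {n : ℕ} (hs : Setup T k d c r o s) (hc : c < 2 * m + 2) {t : ℕ}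
    {a : ZMod (2 * m + 1)} (ht : s.nat 12 0 0 = t) (ha : s.nat 13 0 0 = a.val)
    (hp : s.nat 15 0 0 = (dayIndex (r : ZMod (2 * m + 1)) t - 2 * a).val)
    (hf : s.nat 17 0 0 =
      flagVal (xor (hosts k o (dayIndex (r : ZMod (2 * m + 1)) t) (some a))
        (decide (2 * m + 1 ≤ t)))) :
    Reaches n gameProg s fun s' =>
      (∀ t' i, GameAt (naming hT c) k o r s t' i → GameAt (naming hT c) k o r s' t' i) ∧
      GameAt (naming hT c) k o r s' t (naming hT c (some a)) ∧
      (dayIndex (r : ZMod (2 * m + 1)) t = 2 * a →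
        GameAt (naming hT c) k o r s' t (naming hT c none)) := by
  have hal := ZMod.val_lt a
  have hname : s.nat 2 0 (c + 1 + a.val) = naming hT c (some a) := by
    rw [hs.tour _ (by omega), naming_some]
  have hcen : s.nat 2 0 c = naming hT c none := by
    rw [hs.tour _ (by omega), naming_none]
  set u := dayIndex (r : ZMod (2 * m + 1)) t with hu
  have hpl := ZMod.val_lt (u - 2 * a)
  have hp0 : (u - 2 * a).val = 0 ↔ u = 2 * a := by rw [ZMod.val_eq_zero, sub_eq_zero]
  have h9 := hs.center
  have hne : ((naming hT c none : Fin (2 * m + 2)) : ℕ) ≠ naming hT c (some a) := by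
    rw [Ne, Fin.val_inj, (naming hT c).injective.eq_iff]
    simp
  have hgame₁ : ∀ s' : Store, u ≠ 2 * a →
      GameAt (naming hT c) k o r s' t (naming hT c (some a)) →
      (∀ (t' : ℕ) (i : Fin (2 * m + 2)), ¬ (t' = t ∧ (i : ℕ) = naming hT c (some a)) →
        s'.nat 3 t' i = s.nat 3 t' i ∧ s'.nat 4 t' i = s.nat 4 t' i) →
      (∀ t' i, GameAt (naming hT c) k o r s t' i → GameAt (naming hT c) k o r s' t' i) ∧
      GameAt (naming hT c) k o r s' t (naming hT c (some a)) ∧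
      (u = 2 * a → GameAt (naming hT c) k o r s' t (naming hT c none)) := by
    refine fun s' huz h1 h3 => ⟨fun t' i h => ?_, h1, fun h => absurd h huz⟩
    by_cases c1 : t' = t ∧ (i : ℕ) = naming hT c (some a)
    · rwa [c1.1, Fin.ext c1.2]
    obtain ⟨h4, h5⟩ := h3 t' i c1
    unfold GameAt
    rw [h4, h5]
    exact h
  have hgame₂ : ∀ s' : Store, GameAt (naming hT c) k o r s' t (naming hT c (some a)) →
      GameAt (naming hT c) k o r s' t (naming hT c none) →
      (∀ (t' : ℕ) (i : Fin (2 * m + 2)), ¬ (t' = t ∧ (i : ℕ) = naming hT c (some a)) →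
        ¬ (t' = t ∧ (i : ℕ) = naming hT c none) →
        s'.nat 3 t' i = s.nat 3 t' i ∧ s'.nat 4 t' i = s.nat 4 t' i) →
      (∀ t' i, GameAt (naming hT c) k o r s t' i → GameAt (naming hT c) k o r s' t' i) ∧
      GameAt (naming hT c) k o r s' t (naming hT c (some a)) ∧
      (u = 2 * a → GameAt (naming hT c) k o r s' t (naming hT c none)) := by
    refine fun s' h1 h2 h3 => ⟨fun t' i h => ?_, h1, fun _ => h2⟩
    by_cases c1 : t' = t ∧ (i : ℕ) = naming hT c (some a)
    · rwa [c1.1, Fin.ext c1.2]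
    by_cases c2 : t' = t ∧ (i : ℕ) = naming hT c none
    · rwa [c2.1, Fin.ext c2.2]
    obtain ⟨h4, h5⟩ := h3 t' i c1 c2
    unfold GameAt
    rw [h4, h5]
    exact h
  refine .seq (.setNat (.ite (fun h => .seq (.setNat (.seq (.setNat (.setNat ?_)))))
    (fun h => .setNat ?_)))
  · have huz : u = 2 * a := by
      rw [← hp0]
      simpa [Test.Holds, NExp.eval, eval_var, Store.setNat_nat, hp] using h
    have ho1 : opponent u (some a) = none := opponent_some_eq_none.2 huz
    have ho2 : opponent u none = some a := opponent_none_eq_some.2 huz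
    have hh : hosts k o u none = !hosts k o u (some a) := by rw [← ho1, hosts_opponent]
    simp only [nameExp, centerExp, NExp.eval, eval_var, Store.setNat_nat, ht, ha, hf, h9, hname,
      hcen, Nat.reduceEqDiff, false_and, if_false]
    refine hgame₂ _ ?_ ?_ ?_
    · simp only [GameAt, Equiv.symm_apply_apply, ← hu, ho1]
      simp [Store.setNat_nat, hne.symm]
    · simp only [GameAt, Equiv.symm_apply_apply, ← hu, ho2, hh, Bool.not_xor, flagVal_not]
      simp [Store.setNat_nat]
    · intro t' i n1 n2
      simp [Store.setNat_nat, n1, n2]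
  · have huz : u ≠ 2 * a := by
      rw [Ne, ← hp0]
      simpa [Test.Holds, NExp.eval, eval_var, Store.setNat_nat, hp] using h
    have ho1 : opponent u (some a) = some (u - a) := if_neg huz
    have hrem : s.nat 5 0 (a.val + (u - 2 * a).val) = (u - a).val := by
      rw [hs.rem _ (by omega), ← ZMod.val_natCast]
      push_cast
      rw [ZMod.natCast_zmod_val, ZMod.natCast_zmod_val]
      congr 1
      ring
    have hname' : s.nat 2 0 (c + 1 + (u - a).val) = naming hT c (some (u - a)) := by
      have := ZMod.val_lt (u - a)
      rw [hs.tour _ (by omega), naming_some]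
    simp only [nameExp, NExp.eval, eval_var, Store.setNat_nat, ht, ha, hf, h9, hname, hp, hrem,
      hname', Nat.reduceEqDiff, false_and, if_false]
    refine hgame₁ _ huz ?_ ?_
    · simp only [GameAt, Equiv.symm_apply_apply, ← hu, ho1]
      simp [Store.setNat_nat]
    · intro t' i n1
      simp [Store.setNat_nat, n1]

/-- The program adds 2(2m + 1), which is 0 in the residue ring, so that the representative is at
least 4m, hence at least 2a for every label a. This also explains the length 5n of the remainder
table. -/
theorem dayProg_spec {n : ℕ} (hs : Setup T k d c r o s) {t : ℕ} (ht : s.nat 12 0 0 = t)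
    (htl : t < 2 * (2 * m + 1)) (hr : r < 2 * m + 1) :
    Reaches n dayProg s fun s' =>
      (s'.nat 14 0 0 : ZMod (2 * m + 1)) = dayIndex (r : ZMod (2 * m + 1)) t ∧
      2 * (2 * m) ≤ s'.nat 14 0 0 ∧ s'.nat 14 0 0 < 5 * (2 * m + 2) ∧
      s'.nat 16 0 0 = flagVal (decide (2 * m + 1 ≤ t)) := by
  have hN : ((2 * m + 1 : ℕ) : ZMod (2 * m + 1)) = 0 := ZMod.natCast_self _
  refine .ite (fun h => .seq (.setNat (.setNat ?_))) (fun h => .seq (.setNat (.setNat ?_)))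
  · simp only [Test.Holds, eval_var, hs.cyc, ht] at h
    have e14 : t + r + (2 * m + 1 + (2 * m + 1)) - 2 = t + r + (2 * m + 2 * m) := by omega
    simp only [NExp.eval, eval_var, Store.setNat_nat, ht, hs.cyc, hs.shift,
      Nat.reduceEqDiff, false_and, if_false, and_self, if_true, e14]
    refine ⟨?_, by omega, by omega, ?_⟩
    · rw [dayIndex, if_neg (by omega)]
      push_cast at hN ⊢
      linear_combination 2 * hN
    · rw [decide_eq_true h]; rfl
  · simp only [Test.Holds, eval_var, hs.cyc, ht] at h
    simp only [NExp.eval, eval_var, Store.setNat_nat, ht, hs.cyc, hs.shift,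
      Nat.reduceEqDiff, false_and, if_false, and_self, if_true]
    refine ⟨?_, by omega, by omega, ?_⟩
    · rw [dayIndex, if_pos (by omega)]
      push_cast at hN ⊢
      linear_combination 2 * hN
    · rw [decide_eq_false h]; rfl

theorem buildProg_spec {n : ℕ} (hn : n = 2 * m + 2) (hs : Setup T k d c r o s)
    (hc : c < 2 * m + 2) (hr : r < 2 * m + 1) (ho : o < 2 * m + 2) :
    Reaches n buildProg s fun s' =>
      (circleSchedule (naming hT c) k o (r : ZMod (2 * m + 1))).StoredIn s' := by
  refine .count (fun t s => Setup T k d c r o s ∧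
      ∀ t' < t, ∀ i, GameAt (naming hT c) k o r s t' i) (2 * (2 * m + 1)) (by omega)
    (by decide) ⟨hs.setNat (by simp), by simp⟩ ?_ ?_ fun s h => storedIn_circleSchedule h.2
  · intro t s h
    simp only [NExp.eval, eval_var, h.1.cyc]
    omega
  rintro t s htl ⟨hs, hg⟩ ht
  refine .seq ((dayProg_spec hs ht htl hr).frame fun s₁ hn₁ hr₁ ⟨hw, hw1, hw2, hb⟩ => ?_)
  have hs₁ : Setup T k d c r o s₁ := hs.congr (fun x hx => hn₁ x (by
    fin_cases hx <;> decide)) (hr₁ 0 (by decide))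
  have ht₁ : s₁.nat 12 0 0 = t := by rw [hn₁ 12 (by decide), ht]
  have hg₁ : ∀ t' < t, ∀ i, GameAt (naming hT c) k o r s₁ t' i := fun t' h i =>
    (hg t' h i).congr (hn₁ 3 (by decide)) (hn₁ 4 (by decide))
  refine .count (fun x s' => Setup T k d c r o s' ∧ s'.nat 12 = s₁.nat 12
      ∧ s'.nat 14 = s₁.nat 14 ∧ s'.nat 16 = s₁.nat 16
      ∧ (∀ t' < t, ∀ i, GameAt (naming hT c) k o r s' t' i)
      ∧ ∀ a : ZMod (2 * m + 1), a.val < x → GameAt (naming hT c) k o r s' t (naming hT c (some a))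
        ∧ (dayIndex (r : ZMod (2 * m + 1)) t = 2 * a →
          GameAt (naming hT c) k o r s' t (naming hT c none)))
    (2 * m + 1) (by omega) (by decide) ?_ ?_ ?_ ?_
  · exact ⟨hs₁.setNat (by simp), rfl, rfl, rfl,
      fun t' h i => (hg₁ t' h i).setNat (by simp) (by simp), by simp⟩
  · rintro x s' ⟨h, _⟩
    exact h.cyc
  · rintro x s₂ hx ⟨hs₂, h12, h14, h16, hgl, hga⟩ h13
    have hxv : ((x : ℕ) : ZMod (2 * m + 1)).val = x := by
      rw [ZMod.val_natCast, Nat.mod_eq_of_lt hx]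
    refine .seq ((flagProg_spec (u := dayIndex (r : ZMod (2 * m + 1)) t)
      (a := (x : ZMod (2 * m + 1))) (b := decide (2 * m + 1 ≤ t)) hs₂.toReady hs₂.offset ho
      (by rw [h13, hxv]) (by rw [h14, hw]) (by rw [h14, hxv]; omega) (by rw [h14]; exact hw2)
      (by rw [h16, hb])).frame fun s₃ hn₃ hr₃ ⟨h15, h17⟩ => ?_)
    have hs₃ : Setup T k d c r o s₃ := hs₂.congr (fun y hy => hn₃ y (by
      fin_cases hy <;> decide)) (hr₃ 0 (by decide))
    refine (gameProg_spec hT hs₃ hc (t := t) (a := (x : ZMod (2 * m + 1)))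
      (by rw [hn₃ 12 (by decide), h12, ht₁]) (by rw [hn₃ 13 (by decide), h13, hxv]) h15
      h17).frame fun s₄ hn₄ hr₄ ⟨hmono, hga', hgc'⟩ => ?_
    have hs₄ : Setup T k d c r o s₄ := hs₃.congr (fun y hy => hn₄ y (by
      fin_cases hy <;> decide)) (hr₄ 0 (by decide))
    have hmono' : ∀ t' i, GameAt (naming hT c) k o r s₂ t' i →
        GameAt (naming hT c) k o r (s₄.setNat 13 0 0 (x + 1)) t' i := fun t' i h =>
      (hmono t' i (h.congr (hn₃ 3 (by decide)) (hn₃ 4 (by decide)))).setNat (by simp) (by simp)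
    have hset : ∀ y, y ≠ 13 → y ∉ gameProg.natWrites → y ∉ flagProg.natWrites →
        (s₄.setNat 13 0 0 (x + 1)).nat y = s₂.nat y := by
      intro y h1 h2 h3
      rw [← hn₃ y h3, ← hn₄ y h2]
      funext i j
      exact setNat_nat_of_ne _ _ _ _ _ _ h1
    refine ⟨hs₄.setNat (by simp), ?_, ?_, ?_, fun t' h i => hmono' _ _ (hgl t' h i), ?_⟩
    · rw [hset 12 (by decide) (by decide) (by decide), h12]
    · rw [hset 14 (by decide) (by decide) (by decide), h14]
    · rw [hset 16 (by decide) (by decide) (by decide), h16]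
    · intro a ha
      rcases Nat.lt_succ_iff_lt_or_eq.1 ha with h | h
      · exact ⟨hmono' _ _ (hga a h).1, fun hu => hmono' _ _ ((hga a h).2 hu)⟩
      · obtain rfl : a = (x : ZMod (2 * m + 1)) := ZMod.val_injective _ (by rw [h, hxv])
        exact ⟨hga'.setNat (by simp) (by simp), fun hu => (hgc' hu).setNat (by simp) (by simp)⟩
  · rintro s' ⟨hs', _, _, _, hgl, hga⟩
    refine ⟨hs'.setNat (by simp), fun t' ht' i => ?_⟩
    rcases Nat.lt_succ_iff_lt_or_eq.1 ht' with h | rfl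
    · exact (hgl t' h i).setNat (by simp) (by simp)
    · obtain ⟨x, rfl⟩ := (naming hT c).surjective i
      cases x with
      | some a => exact ((hga a (ZMod.val_lt a)).1).setNat (by simp) (by simp)
      | none =>
        -- The centre's game was written in the round of its opponent, the a with 2a equal to the
        -- day index.
        refine ((hga (half m * dayIndex (r : ZMod (2 * m + 1)) t') (ZMod.val_lt _)).2 ?_).setNat
          (by simp) (by simp)
        linear_combination -(dayIndex (r : ZMod (2 * m + 1)) t') * two_mul_half m

end

theorem travelProg_spec {n : ℕ} (hn : n = 2 * m + 2) {k : ℕ}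
    {d : Fin (2 * m + 2) → Fin (2 * m + 2) → ℝ} {s : Store} (hs : Ready T k d s)
    {S : Schedule (2 * m + 2)} (hS : S.StoredIn s) :
    Reaches n travelProg s fun s' => s'.real 1 0 0 = S.travel d := by
  refine .seq (.setReal ?_)
  simp only [NExp.eval, RExp.eval, sub_self]
  refine .count (fun x s' => Ready T k d s' ∧ S.StoredIn s' ∧ s'.real 1 0 0 =
      ∑ i ∈ Finset.univ.filter (fun i : Fin (2 * m + 2) => i.val < x),
        ∑ t ∈ Finset.range (2 * (2 * m + 2 - 1) + 1), d (S.venue i t) (S.venue i (t + 1)))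
    (2 * m + 2) (by omega) (by decide) ?_ ?_ ?_ ?_
  · refine ⟨(hs.setReal (by simp)).setNat (by simp), hS, ?_⟩
    simp [Store.setNat_real, Store.setReal_real]
  · intro x s' h
    exact h.1.size
  · rintro x s₁ hx ⟨hs₁, hS₁, hacc⟩ h18
    set i : Fin (2 * m + 2) := ⟨x, hx⟩ with hi
    refine .seq (.setNat ?_)
    simp only [NExp.eval, eval_var, h18]
    refine .seq ?_
    -- Cell `19` remembers the current venue of the team; the leg back home after the last day is
    -- added after this loop.
    refine .count (fun t s' => Ready T k d s' ∧ S.StoredIn s' ∧ s'.nat 18 0 0 = x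
        ∧ s'.nat 19 0 0 = S.venue i t
        ∧ s'.real 1 0 0 = s₁.real 1 0 0
          + ∑ t' ∈ Finset.range t, d (S.venue i t') (S.venue i (t' + 1)))
      (2 * (2 * m + 1)) (by omega) (by decide) ?_ ?_ ?_ ?_
    · refine ⟨(hs₁.setNat (by simp)).setNat (by simp), hS₁, ?_, ?_, ?_⟩
      · simp [Store.setNat_nat, h18]
      · simp [Store.setNat_nat, Schedule.venue, hi]
      · simp [Store.setNat_real]
    · intro t s' h
      simp only [NExp.eval, eval_var, h.1.cyc]
      omega
    · rintro t s₂ ht ⟨hs₂, hS₂, h18', h19, hacc'⟩ h12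
      have ht' : t < 2 * (2 * m + 2 - 1) := by omega
      have hSt := hS₂ ⟨t, ht'⟩ i
      have hstep : Reaches n (.ite (.nle (.lit 1) (.cell 4 (.var 12) (.var 18)))
          (.assign 15 (.var 18)) (.assign 15 (.cell 3 (.var 12) (.var 18)))) s₂
          fun s' => s'.nat 15 0 0 = S.venue i (t + 1) := by
        have hv : S.venue i (t + 1) = if S.home ⟨t, ht'⟩ i = true then i else S.opp ⟨t, ht'⟩ i := by
          rw [Schedule.venue, dif_pos ht']
        simp only [hi] at hSt
        refine .ite (fun h => .setNat ?_) (fun h => .setNat ?_)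
        · simp only [Test.Holds, NExp.eval, eval_var, h12, h18', hSt.2] at h
          simp only [NExp.eval, eval_var, setNat_nat_self, h18']
          rw [hv, if_pos]
          by_contra hcon
          rw [if_neg hcon] at h
          omega
        · simp only [Test.Holds, NExp.eval, eval_var, h12, h18', hSt.2] at h
          simp only [NExp.eval, eval_var, setNat_nat_self, h12, h18', hSt.1]
          rw [hv, if_neg]
          intro hcon
          rw [if_pos hcon] at h
          omega
      refine .seq (hstep.frame fun s₃ hn₃ hr₃ h15 => .seq (.setReal (.setNat ?_)))
      have hs₃ : Ready T k d s₃ := hs₂.congr (fun y hy => hn₃ y (by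
        fin_cases hy <;> decide)) (hr₃ 0 (by decide))
      refine ⟨((hs₃.setReal (by simp)).setNat (by simp)).setNat (by simp), ?_, ?_, ?_, ?_⟩
      · intro t' j
        have := hS₂ t' j
        rw [← hn₃ 3 (by decide), ← hn₃ 4 (by decide)] at this
        simpa [Store.setNat_nat, Store.setReal_nat] using this
      · simp [Store.setNat_nat, Store.setReal_nat, hn₃ 18 (by decide), h18']
      · simp [Store.setNat_nat, Store.setReal_nat, NExp.eval, eval_var, h15]
      · have h19' : s₃.nat 19 0 0 = S.venue i t := by rw [hn₃ 19 (by decide), h19]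
        have hd := hs₃.dist (S.venue i t) (S.venue i (t + 1))
        simp only [Store.setNat_real, Store.setReal_real, NExp.eval, RExp.eval, eval_var, h15,
          h19', hd, and_self, if_true]
        rw [hr₃ 1 (by decide), hacc', Finset.sum_range_succ, add_assoc]
    · rintro s₂ ⟨hs₂, hS₂, h18', h19, hacc'⟩
      refine .setReal ⟨(hs₂.setReal (by simp)).setNat (by simp), hS₂, ?_⟩
      have e1 : 2 * (2 * m + 2 - 1) = 2 * (2 * m + 1) := by omega
      have hd : s₂.real 0 (S.venue i (2 * (2 * m + 1))) x = d (S.venue i (2 * (2 * m + 1))) i :=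
        hs₂.dist _ i
      have hlast : S.venue i (2 * (2 * m + 1) + 1) = i := by
        rw [Schedule.venue, dif_neg (by omega)]
      have hfilter : Finset.univ.filter (fun j : Fin (2 * m + 2) => j.val < x + 1) =
          insert i (Finset.univ.filter (fun j : Fin (2 * m + 2) => j.val < x)) := by
        ext j
        simp only [Finset.mem_filter, Finset.mem_univ, true_and, Finset.mem_insert, Fin.ext_iff, hi]
        omega
      simp only [Store.setNat_real, Store.setReal_real, NExp.eval, RExp.eval, eval_var, h18',
        h19, and_self, if_true]
      rw [hfilter, Finset.sum_insert (by simp [hi]), ← hacc, e1, Finset.sum_range_succ, hlast, hd,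
        hacc']
      ring
  · rintro s' ⟨_, _, h⟩
    rw [h, Schedule.travel]
    congr 1
    ext i
    simp

end TTP

/-! ### Tables and exhaustive search over the parameters. -/

namespace TTP

open RAM

/-- Computes the tables. -/
def tableProg : Prog :=
  .seq (.assign 8 (.sub (.var 0) (.lit 1))) <|
  .seq (.count 23 (.var 0)
    (.setNat 2 (.lit 0) (.add (.var 23) (.var 0)) (.cell 2 (.lit 0) (.var 23)))) <|
  .seq (.ite (.nle (.var 1) (.var 0)) (.assign 7 (.var 1)) (.assign 7 (.var 0))) <|
  .seq (.count 23 (.add (.add (.add (.var 0) (.var 0)) (.add (.var 0) (.var 0))) (.var 0))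
    (.ite (.nle (.var 8) (.var 23))
      (.setNat 5 (.lit 0) (.var 23) (.cell 5 (.lit 0) (.sub (.var 23) (.var 8))))
      (.setNat 5 (.lit 0) (.var 23) (.var 23)))) <|
  .count 23 (.add (.var 0) (.var 0))
    (.ite (.nle (.var 7) (.var 23))
      (.setNat 6 (.lit 0) (.var 23)
        (.sub (.lit 1) (.cell 6 (.lit 0) (.sub (.var 23) (.var 7)))))
      (.setNat 6 (.lit 0) (.var 23) (.lit 0)))

/-- Records the current parameters and the travel of their schedule. -/
def recordProg : Prog :=
  .seq (.setReal 2 (.lit 0) (.lit 0) (.cell 1 (.lit 0) (.lit 0))) <|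
  .seq (.assign 20 (.var 9)) <| .seq (.assign 21 (.var 10)) (.assign 22 (.var 11))

/-- Builds the schedule with the current parameters and sends real cell `1` to its travel. -/
def evalProg : Prog := .seq buildProg travelProg

/-- Searches for the parameters whose schedule has the least travel, and builds that schedule. -/
def searchProg : Prog :=
  .seq tableProg <|
  .seq (.assign 9 (.lit 0)) <| .seq (.assign 10 (.lit 0)) <| .seq (.assign 11 (.lit 0)) <|
  .seq evalProg <| .seq recordProg <|
  .seq
    (.count 9 (.var 0) <| .count 10 (.var 8) <| .count 11 (.var 7) <|
      .seq evalProg <|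
        .ite (.rle (.cell 1 (.lit 0) (.lit 0)) (.cell 2 (.lit 0) (.lit 0))) recordProg .skip) <|
  .seq (.assign 9 (.var 20)) <| .seq (.assign 10 (.var 21)) <| .seq (.assign 11 (.var 22)) buildProg

variable {m : ℕ} {v : Fin (2 * m + 2)} {T : (⊤ : SimpleGraph (Fin (2 * m + 2))).Walk v v}

theorem tableProg_spec {k : ℕ} (hk : 2 ≤ k) (hm : 1 ≤ m)
    (d : Fin (2 * m + 2) → Fin (2 * m + 2) → ℝ) :
    Reaches (2 * m + 2) tableProg (input k d T) fun s =>
      Ready T (min k (2 * m + 2)) d s := by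
  have i0 : (input k d T).nat 0 0 0 = 2 * m + 2 := rfl
  have i1 : (input k d T).nat 1 0 0 = k := rfl
  have i2 : ∀ j < 2 * m + 2, (input k d T).nat 2 0 j = tourVert T j := by
    intro j hj
    simp [input, hj, tourVert, Nat.mod_eq_of_lt hj]
  have ir : ∀ i j : Fin (2 * m + 2), (input k d T).real 0 i j = d i j := by
    intro i j
    simp [input, i.isLt, j.isLt]
  generalize input k d T = s at *
  refine .seq (.setNat ?_)
  simp only [NExp.eval, eval_var, i0]
  set s₁ := s.setNat 8 0 0 (2 * m + 2 - 1) with hs₁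
  have h0 : s₁.nat 0 0 0 = 2 * m + 2 := i0
  have htour : Reaches (2 * m + 2) (.count 23 (.var 0)
      (.setNat 2 (.lit 0) (.add (.var 23) (.var 0)) (.cell 2 (.lit 0) (.var 23)))) s₁
      -- The tour is stored twice in a row, so that the index c + 1 + a needs no reduction modulo n.
      fun s' => ∀ j < 2 * (2 * m + 2), s'.nat 2 0 j = tourVert T j := by
    refine .count (fun x s' => s'.nat 0 0 0 = 2 * m + 2
      ∧ ∀ j < 2 * m + 2 + x, s'.nat 2 0 j = tourVert T j) (2 * m + 2) (by omega) (by decide)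
      ⟨i0, i2⟩ (fun x s' h => h.1) ?_ (fun s' h j hj => h.2 j (by omega))
    rintro x s' hx ⟨h0, h2⟩ hc
    refine .setNat ⟨by simp [Store.setNat_nat, h0], fun j hj => ?_⟩
    simp only [NExp.eval, eval_var, hc, h0, h2 x (by omega)]
    rw [setNat_nat_of_ne _ _ _ _ _ _ (by simp), Store.setNat_nat]
    by_cases hjx : j = x + (2 * m + 2)
    · rw [if_pos (by simp [hjx]), hjx, tourVert_add_period]
    · rw [if_neg (by simp [hjx]), h2 j (by omega)]
  refine .seq (htour.frame fun s₂ hn₂ hr₂ ht₂ => ?_)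
  have h02 : s₂.nat 0 0 0 = 2 * m + 2 := by rw [hn₂ 0 (by decide), h0]
  have h12 : s₂.nat 1 0 0 = k := by rw [hn₂ 1 (by decide)]; exact i1
  have h82 : s₂.nat 8 0 0 = 2 * m + 1 := by rw [hn₂ 8 (by decide)]; exact setNat_nat_self ..
  have hd2 : s₂.real 0 = s.real 0 := by rw [hr₂ 0 (by decide)]; rfl
  -- Capping k at n bounds the number of offsets by n, whatever the size of the input k.
  have hmin : Reaches (2 * m + 2)
      (.ite (.nle (.var 1) (.var 0)) (.assign 7 (.var 1)) (.assign 7 (.var 0))) s₂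
      fun s' => s'.nat 7 0 0 = min k (2 * m + 2) := by
    refine .ite (fun h => .setNat ?_) (fun h => .setNat ?_) <;>
    · simp only [Test.Holds, eval_var, h02, h12] at h
      simp only [NExp.eval, eval_var, setNat_nat_self, h02, h12]
      omega
  refine .seq (hmin.frame fun s₃ hn₃ hr₃ h73 => ?_)
  have h03 : s₃.nat 0 0 0 = 2 * m + 2 := by rw [hn₃ 0 (by decide), h02]
  have h83 : s₃.nat 8 0 0 = 2 * m + 1 := by rw [hn₃ 8 (by decide), h82]
  have hrem : Reaches (2 * m + 2)
      (.count 23 (.add (.add (.add (.var 0) (.var 0)) (.add (.var 0) (.var 0))) (.var 0))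
        (.ite (.nle (.var 8) (.var 23))
          (.setNat 5 (.lit 0) (.var 23) (.cell 5 (.lit 0) (.sub (.var 23) (.var 8))))
          (.setNat 5 (.lit 0) (.var 23) (.var 23)))) s₃
      fun s' => ∀ x < 5 * (2 * m + 2), s'.nat 5 0 x = x % (2 * m + 1) := by
    refine .count (fun x s' => s'.nat 0 0 0 = 2 * m + 2 ∧ s'.nat 8 0 0 = 2 * m + 1
      ∧ ∀ y < x, s'.nat 5 0 y = y % (2 * m + 1)) (5 * (2 * m + 2)) (by omega) (by decide)
      ⟨h03, h83, by simp⟩ ?_ ?_ (fun s' h => h.2.2)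
    · intro x s' h
      simp only [NExp.eval, eval_var, h.1]
      omega
    rintro x s' hx ⟨h0, h8, h5⟩ hc
    refine .ite (fun h => .setNat ⟨by simp [Store.setNat_nat, h0], by simp [Store.setNat_nat, h8],
      fun y hy => ?_⟩) (fun h => .setNat ⟨by simp [Store.setNat_nat, h0],
      by simp [Store.setNat_nat, h8], fun y hy => ?_⟩)
    all_goals
      simp only [Test.Holds, eval_var, hc, h8] at h
      simp only [NExp.eval, eval_var, hc, h8]
      rw [setNat_nat_of_ne _ _ _ _ _ _ (by simp), Store.setNat_nat]
      rcases Nat.lt_succ_iff_lt_or_eq.1 hy with hyx | rfl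
      · rw [if_neg (by omega), h5 y hyx]
      rw [if_pos (by simp)]
    -- The table is filled by x mod N = (x - N) mod N, reading an earlier entry.
    · rw [h5 _ (by omega), ← Nat.mod_eq_sub_mod h]
    · rw [Nat.mod_eq_of_lt (by omega)]
  refine .seq (hrem.frame fun s₄ hn₄ hr₄ h54 => ?_)
  have h04 : s₄.nat 0 0 0 = 2 * m + 2 := by rw [hn₄ 0 (by decide), h03]
  have h84 : s₄.nat 8 0 0 = 2 * m + 1 := by rw [hn₄ 8 (by decide), h83]
  have h74 : s₄.nat 7 0 0 = min k (2 * m + 2) := by rw [hn₄ 7 (by decide), h73]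
  have hpar : Reaches (2 * m + 2)
      (.count 23 (.add (.var 0) (.var 0))
        (.ite (.nle (.var 7) (.var 23))
          (.setNat 6 (.lit 0) (.var 23)
            (.sub (.lit 1) (.cell 6 (.lit 0) (.sub (.var 23) (.var 7)))))
          (.setNat 6 (.lit 0) (.var 23) (.lit 0)))) s₄
      fun s' => ∀ x < 2 * (2 * m + 2), s'.nat 6 0 x = x / min k (2 * m + 2) % 2 := by
    have hk0 : 0 < min k (2 * m + 2) := by omega
    generalize min k (2 * m + 2) = k at *
    refine .count (fun x s' => s'.nat 0 0 0 = 2 * m + 2 ∧ s'.nat 7 0 0 = k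
      ∧ ∀ y < x, s'.nat 6 0 y = y / k % 2) (2 * (2 * m + 2)) (by omega) (by decide)
      ⟨h04, h74, by simp⟩ ?_ ?_ (fun s' h => h.2.2)
    · intro x s' h
      simp only [NExp.eval, eval_var, h.1]
      omega
    rintro x s' hx ⟨h0, h7, h6⟩ hc
    refine .ite (fun h => .setNat ⟨by simp [Store.setNat_nat, h0], by simp [Store.setNat_nat, h7],
      fun y hy => ?_⟩) (fun h => .setNat ⟨by simp [Store.setNat_nat, h0],
      by simp [Store.setNat_nat, h7], fun y hy => ?_⟩)
    all_goals
      simp only [Test.Holds, eval_var, hc, h7] at h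
      simp only [NExp.eval, eval_var, hc, h7]
      rw [setNat_nat_of_ne _ _ _ _ _ _ (by simp), Store.setNat_nat]
      rcases Nat.lt_succ_iff_lt_or_eq.1 hy with hyx | rfl
      · rw [if_neg (by omega), h6 y hyx]
      rw [if_pos (by simp)]
    -- Going back by k lowers the quotient by one, so the parity flips.
    · rw [h6 _ (by omega), Nat.div_eq_sub_div hk0 h]
      omega
    · rw [Nat.div_eq_of_lt (by omega)]
  refine hpar.frame fun s₅ hn₅ hr₅ h65 => ?_
  exact
    { size := by rw [hn₅ 0 (by decide), h04]
      cyc := by rw [hn₅ 8 (by decide), h84]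
      bnd := by rw [hn₅ 7 (by decide), h74]
      tour := by rw [hn₅ 2 (by decide), hn₄ 2 (by decide), hn₃ 2 (by decide)]; exact ht₂
      rem := by rw [hn₅ 5 (by decide)]; exact h54
      par := h65
      dist := by
        rw [hr₅ 0 (by decide), hr₄ 0 (by decide), hr₃ 0 (by decide), hd2]; exact ir }

section

variable (hT : T.IsHamiltonianCycle) {k : ℕ} {d : Fin (2 * m + 2) → Fin (2 * m + 2) → ℝ}

/-- The travel of the schedule with parameters `c`, `r`, `o`. -/
noncomputable def travelOf (k : ℕ) (d : Fin (2 * m + 2) → Fin (2 * m + 2) → ℝ) (c r o : ℕ) : ℝ :=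
  (circleSchedule (naming hT c) k o (r : ZMod (2 * m + 1))).travel d

theorem evalProg_spec {c r o : ℕ} {s : Store} (hs : Setup T k d c r o s)
    (hc : c < 2 * m + 2) (hr : r < 2 * m + 1) (ho : o < 2 * m + 2) :
    Reaches (2 * m + 2) evalProg s fun s' => s'.real 1 0 0 = travelOf hT k d c r o :=
  .seq ((buildProg_spec hT rfl hs hc hr ho).frame fun _ hn₁ hr₁ h₁ =>
    travelProg_spec rfl (hs.toReady.congr
      (fun y hy => hn₁ y (by fin_cases hy <;> decide)) (hr₁ 0 (by decide))) h₁)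

/-- The recorded parameters are admissible and real cell `2` holds the travel of their schedule. -/
structure Recorded (k : ℕ) (d : Fin (2 * m + 2) → Fin (2 * m + 2) → ℝ) (s : Store) : Prop
    extends Ready T k d s where
  center_lt : s.nat 20 0 0 < 2 * m + 2
  shift_lt : s.nat 21 0 0 < 2 * m + 1
  offset_lt : s.nat 22 0 0 < k
  best : s.real 2 0 0 = travelOf hT k d (s.nat 20 0 0) (s.nat 21 0 0) (s.nat 22 0 0)

variable {hT}

theorem Recorded.congr {s s' : Store} (h : Recorded hT k d s)
    (hn : ∀ x ∈ [0, 2, 5, 6, 7, 8, 20, 21, 22], s'.nat x = s.nat x)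
    (hr : ∀ x ∈ [0, 2], s'.real x = s.real x) : Recorded hT k d s' where
  toReady := h.toReady.congr (fun x hx => hn x (by simp at hx ⊢; tauto)) (hr 0 (by simp))
  center_lt := by rw [hn 20 (by simp)]; exact h.center_lt
  shift_lt := by rw [hn 21 (by simp)]; exact h.shift_lt
  offset_lt := by rw [hn 22 (by simp)]; exact h.offset_lt
  best := by
    rw [hn 20 (by simp), hn 21 (by simp), hn 22 (by simp), hr 2 (by simp)]; exact h.best

theorem Recorded.setNat {s : Store} {x i j w : ℕ} (h : Recorded hT k d s)
    (hx : x ∉ [0, 2, 5, 6, 7, 8, 20, 21, 22]) : Recorded hT k d (s.setNat x i j w) := by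
  refine h.congr (fun y hy => ?_) (fun _ _ => rfl)
  funext i' j'
  exact setNat_nat_of_ne _ _ _ _ _ _ fun hxy => hx (hxy ▸ hy)

theorem recordProg_spec {c r o : ℕ} {s : Store} (hs : Setup T k d c r o s)
    (hc : c < 2 * m + 2) (hr : r < 2 * m + 1) (ho : o < k)
    (h1 : s.real 1 0 0 = travelOf hT k d c r o) :
    Reaches (2 * m + 2) recordProg s fun s' =>
      Recorded hT k d s' ∧ s'.real 2 0 0 = travelOf hT k d c r o := by
  have h9 := hs.center
  have h10 := hs.shift
  have h11 := hs.offset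
  refine .seq (.setReal (.seq (.setNat (.seq (.setNat (.setNat ?_))))))
  refine ⟨⟨(((hs.toReady.setReal (by simp)).setNat (by simp)).setNat (by simp)).setNat (by simp),
    ?_, ?_, ?_, ?_⟩, ?_⟩ <;>
  simp [NExp.eval, RExp.eval, eval_var, Store.setNat_nat, Store.setNat_real, Store.setReal_nat,
    Store.setReal_real, h9, h10, h11, hc, hr, ho, h1]

/-- The averaging arguments only assert that good parameters exist; minimality over all triples lets
the output inherit their bounds. Recording the triple (0, 0, 0) first gives the comparison a
meaningful starting value. -/
theorem searchProg_spec (hk : 2 ≤ k) (hm : 1 ≤ m) (d : Fin (2 * m + 2) → Fin (2 * m + 2) → ℝ) :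
    Reaches (2 * m + 2) searchProg (input k d T) fun s =>
      ∃ c r o : ℕ, o < min k (2 * m + 2) ∧
        (circleSchedule (naming hT c) (min k (2 * m + 2)) o (r : ZMod (2 * m + 1))).StoredIn s ∧
        ∀ c' < 2 * m + 2, ∀ r' < 2 * m + 1, ∀ o' < min k (2 * m + 2),
          travelOf hT (min k (2 * m + 2)) d c r o ≤
            travelOf hT (min k (2 * m + 2)) d c' r' o' := by
  refine .seq ((tableProg_spec hk hm d).mono fun s₁ hs₁ => ?_)
  have hkn : min k (2 * m + 2) ≤ 2 * m + 2 := min_le_right _ _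
  have hk0 : 0 < min k (2 * m + 2) := by omega
  generalize min k (2 * m + 2) = k at *
  refine .seq (.setNat (.seq (.setNat (.seq (.setNat ?_)))))
  simp only [NExp.eval]
  have hs₂ : Setup T k d 0 0 0 (((s₁.setNat 9 0 0 0).setNat 10 0 0 0).setNat 11 0 0 0) :=
    ⟨((hs₁.setNat (by simp)).setNat (by simp)).setNat (by simp), rfl, rfl, rfl⟩
  refine .seq ((evalProg_spec hT hs₂ (by omega) (by omega) (by omega)).frame
    fun s₃ hn₃ hr₃ h₃ => ?_)
  have hs₃ : Setup T k d 0 0 0 s₃ := hs₂.congr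
    (fun y hy => hn₃ y (by fin_cases hy <;> decide)) (hr₃ 0 (by decide))
  refine .seq ((recordProg_spec hs₃ (by omega) (by omega) hk0 h₃).mono fun s₄ h₄ => ?_)
  have hrec : Recorded hT k d s₄ := h₄.1
  clear h₄ hs₃ h₃ hn₃ hr₃ hs₂ hs₁
  refine .seq (.count (fun c s => Recorded hT k d s ∧
      ∀ c' < c, ∀ r' < 2 * m + 1, ∀ o' < k, s.real 2 0 0 ≤ travelOf hT k d c' r' o')
    (2 * m + 2) (by omega) (by decide) ⟨hrec.setNat (by simp), by simp⟩
    (fun _ _ h => h.1.size) ?_ ?_)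
  · rintro c s hc ⟨hR, hle⟩ h9
    refine .count (fun r s' => Recorded hT k d s' ∧ s'.nat 9 0 0 = c ∧
        (∀ c' < c, ∀ r' < 2 * m + 1, ∀ o' < k, s'.real 2 0 0 ≤ travelOf hT k d c' r' o') ∧
        ∀ r' < r, ∀ o' < k, s'.real 2 0 0 ≤ travelOf hT k d c r' o')
      (2 * m + 1) (by omega) (by decide) ⟨hR.setNat (by simp), h9, hle, by simp⟩
      (fun _ _ h => h.1.cyc) ?_ ?_
    · rintro r s hr ⟨hR, h9, hle, hle'⟩ h10
      refine .count (fun o s' => Recorded hT k d s' ∧ s'.nat 9 0 0 = c ∧ s'.nat 10 0 0 = r ∧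
          (∀ c' < c, ∀ r' < 2 * m + 1, ∀ o' < k, s'.real 2 0 0 ≤ travelOf hT k d c' r' o') ∧
          (∀ r' < r, ∀ o' < k, s'.real 2 0 0 ≤ travelOf hT k d c r' o') ∧
          ∀ o' < o, s'.real 2 0 0 ≤ travelOf hT k d c r o')
        k (by omega) (by decide) ⟨hR.setNat (by simp), h9, h10, hle, hle', by simp⟩
        (fun _ _ h => h.1.bnd) ?_ ?_
      · rintro o s ho ⟨hR, h9, h10, hle, hle', hle''⟩ h11
        have hS : Setup T k d c r o s := ⟨hR.toReady, h9, h10, h11⟩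
        refine .seq ((evalProg_spec hT hS hc hr (by omega)).frame fun s' hn' hr' h1 => ?_)
        have hS' : Setup T k d c r o s' := hS.congr
          (fun y hy => hn' y (by fin_cases hy <;> decide)) (hr' 0 (by decide))
        have hR' : Recorded hT k d s' := hR.congr
          (fun y hy => hn' y (by fin_cases hy <;> decide))
          (fun y hy => hr' y (by fin_cases hy <;> decide))
        have h2 : s'.real 2 = s.real 2 := hr' 2 (by decide)
        refine .ite (fun h => ?_) (fun h => .skip ?_)
        · simp only [Test.Holds, RExp.eval, NExp.eval, h2, h1] at h
          refine (recordProg_spec hS' hc hr ho h1).frame fun s'' hn'' _ ⟨hR'', h2''⟩ => ?_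
          simp only [Store.setNat_real, h2'']
          refine ⟨hR''.setNat (by simp), ?_, ?_, fun c' hc' r' hr' o' ho' =>
            h.trans (hle c' hc' r' hr' o' ho'), fun r' hr' o' ho' => h.trans (hle' r' hr' o' ho'),
            fun o' ho' => ?_⟩
          · rw [setNat_nat_of_ne _ _ _ _ _ _ (by simp), hn'' 9 (by decide), hS'.center]
          · rw [setNat_nat_of_ne _ _ _ _ _ _ (by simp), hn'' 10 (by decide), hS'.shift]
          · rcases Nat.lt_succ_iff_lt_or_eq.1 ho' with ho' | rfl
            · exact h.trans (hle'' o' ho')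
            · exact le_rfl
        · simp only [Test.Holds, RExp.eval, NExp.eval, h2, h1, not_le] at h
          simp only [Store.setNat_real, h2]
          refine ⟨hR'.setNat (by simp), hS'.center, hS'.shift, hle, hle', fun o' ho' => ?_⟩
          rcases Nat.lt_succ_iff_lt_or_eq.1 ho' with ho' | rfl
          · exact hle'' o' ho'
          · exact h.le
      · rintro s ⟨hR, h9, _, hle, hle', hle''⟩
        refine ⟨hR.setNat (by simp), h9, hle, fun r' hr' => ?_⟩
        rcases Nat.lt_succ_iff_lt_or_eq.1 hr' with hr' | rfl
        · exact hle' r' hr'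
        · exact hle''
    · rintro s ⟨hR, _, hle, hle'⟩
      refine ⟨hR.setNat (by simp), fun c' hc' => ?_⟩
      rcases Nat.lt_succ_iff_lt_or_eq.1 hc' with hc' | rfl
      · exact hle c' hc'
      · exact hle'
  · rintro s ⟨hR, hle⟩
    refine .seq (.setNat (.seq (.setNat (.seq (.setNat ?_)))))
    simp only [NExp.eval, eval_var]
    refine (buildProg_spec hT rfl (c := s.nat 20 0 0) (r := s.nat 21 0 0) (o := s.nat 22 0 0)
      (k := k) (d := d) ⟨((hR.toReady.setNat (by simp)).setNat (by simp)).setNat (by simp),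
        ?_, ?_, ?_⟩ hR.center_lt hR.shift_lt (hR.offset_lt.trans_le hkn)).mono fun s' h =>
      ⟨_, _, _, hR.offset_lt, h, fun c' hc' r' hr' o' ho' => ?_⟩
    · simp [Store.setNat_nat]
    · simp [Store.setNat_nat]
    · simp [Store.setNat_nat]
    · rw [← hR.best]
      exact hle c' hc' r' hr' o' ho'

end

end TTP

theorem mainTheorem2 :
    ∃ (prog : RAM.Prog) (p : Polynomial ℕ),
      ∀ (n k : ℕ), 4 ≤ n → Even n → 2 ≤ k →
      ∀ (d : Fin n → Fin n → ℝ), TTP.IsDistance d →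
      ∀ (v : Fin n) (T : (⊤ : SimpleGraph (Fin n)).Walk v v), T.IsHamiltonianCycle →
      ∃ (t : ℕ) (s : RAM.Store) (S : TTP.Schedule n),
        RAM.Exec prog (TTP.input k d T) t s ∧
        t ≤ p.eval n ∧
        S.StoredIn s ∧
        S.IsFeasible k ∧
        S.travel d ≤ 10 / (n : ℝ) * TTP.totalSum d + 2 / (k : ℝ) * TTP.totalSum d
          + (1 - 1 / (k : ℝ)) * n * TTP.walkLength d T ∧
        ((n : ℝ) / 2 ≤ k →
          S.travel d ≤ 10 / (n : ℝ) * TTP.totalSum d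
            + (1 - 1 / (k : ℝ)) * n * TTP.walkLength d T) := by
  refine ⟨TTP.searchProg, TTP.searchProg.bound, ?_⟩
  intro n k hn hne hk d hd v T hT
  obtain ⟨m, rfl⟩ : ∃ m, n = 2 * m + 2 := by
    obtain ⟨l, rfl⟩ := hne
    exact ⟨l - 1, by omega⟩
  have hm : 1 ≤ m := by omega
  obtain ⟨t, s, hex, ht, c, r, o, ho, hst, hmin⟩ := TTP.searchProg_spec (hT := hT) hk hm d
  refine ⟨t, s, _, hex, ht, hst,
    -- A schedule built with blocks of length min k n respects the weaker bound k.
    TTP.circleSchedule_isFeasible hm (by omega) ho (min_le_left _ _) _ _, ?_⟩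
  have hmin' : ∀ c' < 2 * m + 2, ∀ r' : ZMod (2 * m + 1), ∀ o' < min k (2 * m + 2),
      (TTP.circleSchedule (TTP.naming hT c) (min k (2 * m + 2)) o
        r).travel d ≤
      (TTP.circleSchedule (TTP.naming hT c') (min k (2 * m + 2)) o' r').travel d := by
    intro c' hc' r' o' ho'
    have := hmin c' hc' r'.val (ZMod.val_lt r') o' ho'
    rwa [TTP.travelOf, TTP.travelOf, ZMod.natCast_zmod_val] at this
  obtain ⟨c', hc', hS⟩ := TTP.exists_center hT hd
  have hL := TTP.chordSum_naming_le hT hd c'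
  have hL0 : 0 ≤ TTP.walkLength d T :=
    (TTP.chordSum_nonneg (hd.isPseudoDist (TTP.naming hT c')) 1).trans hL
  have hΔ := TTP.totalSum_nonneg hd
  have hk0 : (0 : ℝ) < k := by positivity
  have hcast : ((2 * m + 2 : ℕ) : ℝ) = 2 * m + 2 := by push_cast; ring
  have hdiv : 10 * (TTP.totalSum d / (2 * m + 2)) =
      10 / ((2 * m + 2 : ℕ) : ℝ) * TTP.totalSum d := by rw [hcast]; ring
  -- The threshold m + 1 is n/2. Above it the sharper bound holds and implies the general one,
  -- because the term 2Δ/k is nonnegative; below it the second claim is vacuous.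
  by_cases hkm : m + 1 ≤ k
  · obtain ⟨r', hr'⟩ := TTP.exists_travel_le_of_le hm hd (TTP.naming hT c')
      (k := min k (2 * m + 2)) (by omega) hS hL
    have h1 := (hmin' c' hc' r' 0 (by omega)).trans hr'
    have hkm' : (m : ℝ) + 1 ≤ k := by exact_mod_cast hkm
    -- This is n - 2 ≤ n - n/k, that is, n/k ≤ 2.
    have h2 : 2 * (m : ℝ) ≤ (1 - 1 / (k : ℝ)) * ((2 * m + 2 : ℕ) : ℝ) := by
      have h3 : (2 * (m : ℝ) + 2) / k ≤ 2 := by rw [div_le_iff₀ hk0]; linarith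
      rw [hcast]
      have h4 : (1 - 1 / (k : ℝ)) * (2 * m + 2) = 2 * m + 2 - (2 * m + 2) / k := by ring
      linarith
    have h3 := mul_le_mul_of_nonneg_right h2 hL0
    have h4 : 0 ≤ 2 / (k : ℝ) * TTP.totalSum d := by positivity
    rw [hdiv] at h1
    exact ⟨by linarith, fun _ => by linarith⟩
  · have hmk : min k (2 * m + 2) = k := min_eq_left (by omega)
    rw [hmk] at hmin' ⊢
    obtain ⟨o', ho', r', hr'⟩ := TTP.exists_travel_le hm hd (TTP.naming hT c') hk hS hL
    have h1 := (hmin' c' hc' r' o' ho').trans hr'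
    rw [hdiv, ← hcast] at h1
    refine ⟨h1, fun h => absurd ?_ hkm⟩
    rw [hcast] at h
    have : ((m + 1 : ℕ) : ℝ) ≤ k := by push_cast; linarith
    exact_mod_cast this
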